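/- **Universal consistency of the online BSP-Forest.** Let $d\ge 2$, let $\mathcal K$ be a finite set of labels, and let $\mu$ be any probability distribution on $\mathbb R^d\times\mathcal K$. Let $(\boldsymbol x_1,y_1),(\boldsymbol x_2,y_2),\dots$ and $(\boldsymbol x,y)$ be i.i.d. with law $\mu$, let $\tau_1,\tau_2,\dots$ be real budgets, and fix a number of trees $M\ge 1$ and an integer $r\ge 0$ (blocks with at most $r$ data points are never cut). For a bounded convex set $\Diamond\subset\mathbb R^d$ and $d_1<d_2$ let $\Pi_{d_1,d_2}(\Diamond)\subset\mathbb R^2$ be its projection onto the coordinates $d_1,d_2$, let $\boldsymbol l_{d_1,d_2}(\theta)=\{u_1\cos\theta+u_2\sin\theta: u\in \Pi_{d_1,d_2}(\Diamond)\}$ be the shadow of this projection in the direction of angle $\theta$, and let $L_{d_1,d_2}(\Diamond)=\int_0^\pi|\boldsymbol l_{d_1,d_2}(\theta)|\,d\theta$ be its perimeter (twice the length for a segment). Given $\boldsymbol x_1,\dots,\boldsymbol x_n$, a BSP-tree with law $\mathrm{BSP}_{\boldsymbol x}(\boldsymbol x_{1:n},\tau_n)$ is generated recursively from the node holding all $n$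 points with remaining budget $\tau=\tau_n$: a node with remaining budget $\tau$ whose points have convex hull $\Diamond$ is a leaf if it holds at most $r$ points; otherwise draw a cost $c\sim\mathrm{Exp}(\sum_{d_1<d_2}L_{d_1,d_2}(\Diamond))$ ($c=+\infty$ if the rate is $0$); if $c\ge\tau$ the node is a leaf; if $c<\tau$, draw a pair $(d_1,d_2)$ with probability proportional to $L_{d_1,d_2}(\Diamond)$, an angle $\theta\in(0,\pi]$ with density proportional to $|\boldsymbol l_{d_1,d_2}(\theta)|$ and a position $s$ uniformly on $\boldsymbol l_{d_1,d_2}(\theta)$, split the points of the node by the hyperplane $\{z: z_{d_1}\cos\theta+z_{d_2}\sin\theta=s\}$, and treat the two parts independently in the same way, each with remaining budget $\tau-c$. The online BSP-Forest after $n$ data points consists of $M$ trees which, given the data, are independent with this law and do not depend on the labels, nor on $(\boldsymbol x,y)$. Each tree predicts at a point of $\mathbb R^d$ a label with the most votes among the labels of the training points in the leaf that the point reaches by following the cuts, and the forest classifier $g_n$ predicts a label with the most votes among the $M$ tree predictions (ties broken by any fixed rule). Let $\ell_n=\mathbb P\big(g_n(\boldsymbol x)\ne y\,\big|\,(\boldsymbol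 x_i,y_i)_{i=1}^n\big)$, and let $\ell^*$ be the Bayes error, the infimum of $\mathbb P(g(\boldsymbol x)\neq y)$ over measurable $g:\mathbb R^d\to\mathcal K$. If $\tau_n\to\infty$ and $(\tau_n)^d/n\to0$ as $n\to\infty$, then $\lim_{n\to\infty}\mathbb E[\ell_n]=\ell^*$. -/

import Mathlib

open MeasureTheory ProbabilityTheory Filter Topology

namespace BSPForest

noncomputable section

/-! ### Blocks, their planar projections and perimeters -/

/-- The feature space `ℝ^d`. -/
abbrev Feature (d : ℕ) : Type := EuclideanSpace ℝ (Fin d)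

/-- The projection of `ℝ^d` onto the two coordinates of `p`. -/
def proj {d : ℕ} (p : Fin d × Fin d) (z : Feature d) : EuclideanSpace ℝ (Fin 2) :=
  !₂[z p.1, z p.2]

/-- The set `𝒟` of two-dimensional coordinate pairs `(d₁, d₂)`, `d₁ < d₂`. -/
def pairs (d : ℕ) : Finset (Fin d × Fin d) := Finset.univ.filter fun p => p.1 < p.2

/-- The coordinate of a planar point along the direction `(cos θ, sin θ)`. -/
def along (θ : ℝ) (y : EuclideanSpace ℝ (Fin 2)) : ℝ := y 0 * Real.cos θ + y 1 * Real.sin θ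

/-- The segment `l_P(θ)`: the shadow of the planar set `P` in the direction of angle `θ`,
described by the coordinate along that direction. -/
def shadow (P : Set (EuclideanSpace ℝ (Fin 2))) (θ : ℝ) : Set ℝ := along θ '' P

/-- The length `|l_P(θ)|`. -/
def shadowLength (P : Set (EuclideanSpace ℝ (Fin 2))) (θ : ℝ) : ℝ :=
  sSup (shadow P θ) - sInf (shadow P θ)

/-- The perimeter of a bounded convex set `P` of the plane, by Cauchy's formula (the integral of
the width over all directions). A degenerate polygon, that is a segment, has perimeter twice its
length, as the limit of thin triangles. -/
def perimeter (P : Set (EuclideanSpace ℝ (Fin 2))) : ℝ :=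
  ∫ θ in (0 : ℝ)..Real.pi, shadowLength P θ

/-- The sum of the perimeters of all two-dimensional projections of a block. -/
def rate {d : ℕ} (block : Set (Feature d)) : ℝ :=
  ∑ p ∈ pairs d, perimeter (proj p '' block)

/-! ### The law of the first cut of a block -/

/-- The data `(c, (d₁, d₂), θ, s)` of a cut: its cost, its coordinate pair, its angle in `(0, π]`
and its position on the segment `l(θ)`. -/
abbrev Cut (d : ℕ) : Type := ℝ × (Fin d × Fin d) × ℝ × ℝ

/-- The cost of a cut. -/
def Cut.cost {d : ℕ} (C : Cut d) : ℝ := C.1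

/-- The coordinate pair of a cut. -/
def Cut.pair {d : ℕ} (C : Cut d) : Fin d × Fin d := C.2.1

/-- The angle of a cut. -/
def Cut.angle {d : ℕ} (C : Cut d) : ℝ := C.2.2.1

/-- The position of a cut. -/
def Cut.pos {d : ℕ} (C : Cut d) : ℝ := C.2.2.2

/-- `z` lies in the closed half-space on the left of the cutting hyperplane
`{z | z_{d₁} cos θ + z_{d₂} sin θ = s}`, which is parallel to all other coordinates. -/
def Cut.IsLeft {d : ℕ} (C : Cut d) (z : Feature d) : Prop :=
  along C.angle (proj C.pair z) ≤ C.pos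

open scoped Classical in
/-- The joint density of a pair drawn with probability proportional to the perimeter of the
projection, then an angle drawn with density proportional to `|l(θ)|` for that pair, then a
position drawn uniformly on the segment `l(θ)`. -/
def cutDensity {d : ℕ} (block : Set (Feature d)) (q : (Fin d × Fin d) × ℝ × ℝ) : ℝ :=
  (perimeter (proj q.1 '' block) / rate block) *
    (shadowLength (proj q.1 '' block) q.2.1 / perimeter (proj q.1 '' block)) *
    (if q.2.2 ∈ shadow (proj q.1 '' block) q.2.1 then
      (shadowLength (proj q.1 '' block) q.2.1)⁻¹ else 0)

/-- The law of (pair, angle, position) of the first cut of a block. -/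
def hyperplaneLaw {d : ℕ} (block : Set (Feature d)) : Measure ((Fin d × Fin d) × ℝ × ℝ) :=
  ((Measure.count.restrict (pairs d : Set (Fin d × Fin d))).prod
    ((volume.restrict (Set.Ioc 0 Real.pi)).prod volume)).withDensity
      fun q => ENNReal.ofReal (cutDensity block q)

open scoped Classical in
/-- The law of the first cut of a block: the cost is exponential with parameter `rate block`,
independent of the hyperplane. A block all of whose projections have perimeter `0` is one point;
it is never cut (exponential cost of rate `0`, that is `+∞`), and the value chosen here for it is
never used. -/
def cutLaw {d : ℕ} [NeZero d] (block : Set (Feature d)) : Measure (Cut d) :=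
  if 0 < rate block then (expMeasure (rate block)).prod (hyperplaneLaw block)
  else Measure.dirac 0

/-! ### The tree grown on feature points -/

/-- Hierarchical partitions of `n` data points: every node records the data points it holds (its
block is their convex hull), and an internal node records its cut and its two children. -/
inductive Tree (d n : ℕ) : Type
  | leaf (S : Finset (Fin n)) : Tree d n
  | node (S : Finset (Fin n)) (C : Cut d) (left right : Tree d n) : Tree d n

/-- The block of a node: the convex hull of its data points. -/
def hull {d n : ℕ} (x : Fin n → Feature d) (S : Finset (Fin n)) : Set (Feature d) :=
  convexHull ℝ (x '' (S : Set (Fin n)))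

open scoped Classical in
/-- The data points on the left of a cut. -/
def leftPart {d n : ℕ} (x : Fin n → Feature d) (C : Cut d) (S : Finset (Fin n)) :
    Finset (Fin n) := S.filter fun i => C.IsLeft (x i)

open scoped Classical in
/-- The data points on the right of a cut. -/
def rightPart {d n : ℕ} (x : Fin n → Feature d) (C : Cut d) (S : Finset (Fin n)) :
    Finset (Fin n) := S.filter fun i => ¬ C.IsLeft (x i)

open scoped Classical in
/-- The recursive generation of a tree on the data points of `S` with budget `τ`. The candidate
cut of the node holding `S` is `ω S`. It is carried out if its cost is less than the remaining
budget `τ`, and then the two parts are cut recursively with the remaining budget `τ - c`.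
A block with at most `r` data points, or consisting of a single point of space, is not cut.
(The condition that both parts are smaller than `S` holds almost surely, as the hyperplane crosses
the hull.) No node set occurs twice in a tree, so that one candidate cut for each set of data
points is enough. -/
def hullCut {d n : ℕ} (r : ℕ) (x : Fin n → Feature d) (ω : Finset (Fin n) → Cut d) (τ : ℝ)
    (S : Finset (Fin n)) : Tree d n :=
  if r < S.card ∧ 0 < rate (hull x S) ∧ (ω S).cost < τ then
    if h : (leftPart x (ω S) S).card < S.card ∧ (rightPart x (ω S) S).card < S.card then
      Tree.node S (ω S)
        (hullCut r x ω (τ - (ω S).cost) (leftPart x (ω S) S))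
        (hullCut r x ω (τ - (ω S).cost) (rightPart x (ω S) S))
    else Tree.leaf S
  else Tree.leaf S
termination_by S.card
decreasing_by
  · exact h.1
  · exact h.2

/-- The law of the randomness of one tree, given the feature points: independent candidate cuts,
each with the law of the first cut of the corresponding block. With `hullCut` this gives the law
`BSP_x(x_{1:n}, τ_n)` of a tree of the online forest after `n` data points; as the expected error
probability at stage `n` involves only this law, the way in which the trees of different stages
are coupled is irrelevant. -/
def treeLaw {d n : ℕ} [NeZero d] (x : Fin n → Feature d) : Measure (Finset (Fin n) → Cut d) :=
  Measure.pi fun S => cutLaw (hull x S)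

open scoped Classical in
/-- The data points in the leaf that the point `z` reaches by following the cuts of the tree. -/
def Tree.leafOf {d n : ℕ} : Tree d n → Feature d → Finset (Fin n)
  | .leaf S, _ => S
  | .node _ C left right, z => if C.IsLeft z then left.leafOf z else right.leafOf z

/-! ### The forest classifier -/

/-- `sel` is a plurality rule: from the numbers of votes it picks a label with the most votes
(ties are broken in any way). -/
def IsPlurality {K : Type*} (sel : (K → ℕ) → K) : Prop := ∀ (v : K → ℕ) (k : K), v k ≤ v (sel v)

open scoped Classical in
/-- The label predicted at `z` by a tree: the majority vote of the labels in the leaf of `z`. -/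
def treePredict {d n : ℕ} {K : Type*} (sel : (K → ℕ) → K) (y : Fin n → K) (T : Tree d n)
    (z : Feature d) : K :=
  sel fun k => ((T.leafOf z).filter fun i => y i = k).card

open scoped Classical in
/-- The label predicted at `z` by a forest: the majority vote of the trees' predictions. -/
def forestPredict {d n M : ℕ} {K : Type*} (sel : (K → ℕ) → K) (y : Fin n → K)
    (T : Fin M → Tree d n) (z : Feature d) : K :=
  sel fun k => (Finset.univ.filter fun m => treePredict sel y (T m) z = k).card

/-- The error probability `ℓ_n = P(g_n(X) ≠ Y | data)` of the forest of `M` trees, independent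
given the data and grown with budget `τ` on the features of the data. The pair `(X, Y)` has law
`μ` and is independent of the data and of the trees. -/
def errorProb {d n : ℕ} [NeZero d] {K : Type*} [MeasurableSpace K] (μ : Measure (Feature d × K))
    (sel : (K → ℕ) → K) (M r : ℕ) (τ : ℝ) (data : Fin n → Feature d × K) : ℝ :=
  (μ.prod (Measure.pi fun _ : Fin M => treeLaw fun i => (data i).1)).real
    {q | forestPredict sel (fun i => (data i).2)
      (fun m => hullCut r (fun i => (data i).1) (q.2 m) τ Finset.univ) q.1.1 ≠ q.1.2}

/-- The Bayes error: the least error probability of a (measurable) classifier. -/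
def bayesError {d : ℕ} {K : Type*} [MeasurableSpace K] (μ : Measure (Feature d × K)) : ℝ :=
  ⨅ g : {g : Feature d → K // Measurable g}, μ.real {q | g.1 q.1 ≠ q.2}

end

end BSPForest

/-! By Cauchy's formula, `rate (hull x S)` is the mass that the translation invariant measure on
hyperplanes gives to those splitting `S`. Hence, with cost read as time, every hyperplane that
splits a node cuts it at the rate of this one measure, whatever the node. Conditioning on the first
cut gives a renewal equation (`leafMean_eq`) for the mean of any functional of the leaf of a point.
If cuts change a bounded quantity at net rate at most κ, the equation bounds its mean by a factor
exp(κτ) (`growth_bound`). Three values of κ carry the proof.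

With κ = 0, replacing a function on the sample by its leaf averages does not increase its total mass
(`sum_leafMean_average_le`). With κ the rate of a set `P` of sample points, at most m·exp(κτ) points
of `P` lie on average in leaves of at most m points (`sum_leafMean_small_le`). For cells of side 1/τ
the exponent is bounded, and a box has of order τ^d cells, so τ^d/n → 0 makes most leaves large.
With κ = -λ, where λ is the mass of hyperplanes separating a point from a given far region, the leaf
meets that region with probability at most exp(-λτ) (`leafMean_far_le`), so τ → ∞ makes leaves
local.

These bounds concern sample points, whereas the query point is new. `leafMean_le_insert` compares
its leaf with its leaf in the tree grown on the enlarged sample, and exchangeability then turns the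
query point into an average over the sample.

The rest is an argument of Stone's type. Each conditional label probability is approximated in L¹ by
a continuous function with compact support, which is nearly constant on local leaves; the
approximation error is not enlarged by leaf averaging. As trees do not see the labels, the label
frequency in a leaf of more than m points differs from its conditional mean by at most 1/√(m+1) in
mean. A plurality vote loses at most the sum of the frequency errors, and a forest at most the sum
of the losses of its trees. -/

namespace BSPForest

/-! ### The invariant measure on hyperplanes and the law of the first cut -/

noncomputable section

open scoped Classical ENNReal

/-- The space of cutting hyperplanes: a coordinate pair, an angle and a position. -/
abbrev Plane (d : ℕ) : Type := (Fin d × Fin d) × ℝ × ℝ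

/-- The translation invariant measure on hyperplanes. -/
def planeMeasure (d : ℕ) : Measure (Plane d) :=
  (Measure.count.restrict (pairs d : Set (Fin d × Fin d))).prod
    ((volume.restrict (Set.Ioc 0 Real.pi)).prod volume)

instance {d : ℕ} : SigmaFinite (planeMeasure d) := by unfold planeMeasure; infer_instance

/-- The coordinate of `z` along the direction normal to a hyperplane. -/
def height {d : ℕ} (p : Fin d × Fin d) (θ : ℝ) (z : Feature d) : ℝ :=
  z p.1 * Real.cos θ + z p.2 * Real.sin θ

lemma along_proj {d : ℕ} (p : Fin d × Fin d) (θ : ℝ) (z : Feature d) :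
    along θ (proj p z) = height p θ z := by
  simp [along, proj, height]

/-- `z` is on the left of the hyperplane `q`. -/
def Plane.IsLeft {d : ℕ} (q : Plane d) (z : Feature d) : Prop := height q.1 q.2.1 z ≤ q.2.2

lemma Cut.isLeft_iff {d : ℕ} (C : Cut d) (z : Feature d) :
    C.IsLeft z ↔ Plane.IsLeft C.2 z := by
  simp [Cut.IsLeft, Plane.IsLeft, along_proj, Cut.angle, Cut.pair, Cut.pos]

/-- The hyperplanes that split the points of `S`. -/
def splits {d : ℕ} {ι : Type*} (x : ι → Feature d) (S : Finset ι) : Set (Plane d) :=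
  {q | (∃ i ∈ S, q.IsLeft (x i)) ∧ ∃ i ∈ S, ¬ q.IsLeft (x i)}

@[fun_prop]
lemma measurable_height {d : ℕ} {α : Type*} [MeasurableSpace α] {p : α → Fin d × Fin d}
    {θ : α → ℝ} {z : α → Feature d} (hp : Measurable p) (hθ : Measurable θ) (hz : Measurable z) :
    Measurable fun a => height (p a) (θ a) (z a) := by
  have h : Measurable fun b : (Fin d × Fin d) × ℝ × Feature d => height b.1 b.2.1 b.2.2 := by
    apply measurable_from_prod_countable_right
    intro p
    have hc (i : Fin d) : Measurable fun b : ℝ × Feature d => b.2 i :=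
      (EuclideanSpace.proj (𝕜 := ℝ) i).continuous.measurable.comp measurable_snd
    exact ((hc p.1).mul (Real.measurable_cos.comp measurable_fst)).add
      ((hc p.2).mul (Real.measurable_sin.comp measurable_fst))
  exact h.comp (hp.prodMk (hθ.prodMk hz))

lemma measurableSet_isLeft {d : ℕ} {α : Type*} [MeasurableSpace α] {q : α → Plane d}
    {z : α → Feature d} (hq : Measurable q) (hz : Measurable z) :
    MeasurableSet {a | (q a).IsLeft (z a)} :=
  measurableSet_le (by fun_prop) (by fun_prop)

lemma measurableSet_splits_prod {d : ℕ} {ι : Type*} (S : Finset ι) :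
    MeasurableSet {a : (ι → Feature d) × Plane d | a.2 ∈ splits a.1 S} := by
  have h (i : ι) : MeasurableSet {a : (ι → Feature d) × Plane d | a.2.IsLeft (a.1 i)} :=
    measurableSet_isLeft (by fun_prop) (by fun_prop)
  have : {a : (ι → Feature d) × Plane d | a.2 ∈ splits a.1 S} =
      (⋃ i ∈ S, {a | a.2.IsLeft (a.1 i)}) ∩ ⋃ i ∈ S, {a | a.2.IsLeft (a.1 i)}ᶜ := by
    ext a; simp [splits]
  rw [this]
  exact (S.measurableSet_biUnion fun i _ => h i).inter
    (S.measurableSet_biUnion fun i _ => (h i).compl)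

lemma measurableSet_splits {d : ℕ} {ι : Type*} (x : ι → Feature d) (S : Finset ι) :
    MeasurableSet (splits x S) :=
  measurable_prodMk_left (x := x) (measurableSet_splits_prod S)

/-- The highest coordinate of the points of `S`. -/
def hi {d : ℕ} {ι : Type*} (x : ι → Feature d) {S : Finset ι} (hS : S.Nonempty)
    (p : Fin d × Fin d) (θ : ℝ) : ℝ := S.sup' hS fun i => height p θ (x i)

/-- The lowest coordinate of the points of `S`. -/
def lo {d : ℕ} {ι : Type*} (x : ι → Feature d) {S : Finset ι} (hS : S.Nonempty)
    (p : Fin d × Fin d) (θ : ℝ) : ℝ := S.inf' hS fun i => height p θ (x i)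

section HiLo

variable {d : ℕ} {ι : Type*} (x : ι → Feature d) {S : Finset ι} (hS : S.Nonempty)

lemma lo_le_hi (p : Fin d × Fin d) (θ : ℝ) : lo x hS p θ ≤ hi x hS p θ := by
  obtain ⟨i, hi'⟩ := hS
  exact (S.inf'_le _ hi').trans (S.le_sup' (fun i => height p θ (x i)) hi')

/-- The left side is closed, so the position may equal the lowest height but not the highest: the
interval is half-open. -/
lemma mem_splits_iff (q : Plane d) :
    q ∈ splits x S ↔ q.2.2 ∈ Set.Ico (lo x hS q.1 q.2.1) (hi x hS q.1 q.2.1) := by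
  simp [splits, Plane.IsLeft, lo, hi]

lemma continuous_hi (p : Fin d × Fin d) : Continuous (hi x hS p) := by
  unfold hi
  apply Continuous.finset_sup'_apply
  intro i _
  unfold height
  fun_prop

lemma continuous_lo (p : Fin d × Fin d) : Continuous (lo x hS p) := by
  unfold lo
  apply Continuous.finset_inf'_apply
  intro i _
  unfold height
  fun_prop

lemma measurable_hi : Measurable fun q : Plane d => hi x hS q.1 q.2.1 :=
  measurable_from_prod_countable_right fun p => (continuous_hi x hS p).measurable.comp measurable_fst

lemma measurable_lo : Measurable fun q : Plane d => lo x hS q.1 q.2.1 :=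
  measurable_from_prod_countable_right fun p => (continuous_lo x hS p).measurable.comp measurable_fst

end HiLo

section Hull

variable {d n : ℕ} (x : Fin n → Feature d) {S : Finset (Fin n)} (hS : S.Nonempty)

lemma shadow_hull (p : Fin d × Fin d) (θ : ℝ) :
    shadow (proj p '' hull x S) θ = Set.Icc (lo x hS p θ) (hi x hS p θ) := by
  let L : Feature d →ₗ[ℝ] ℝ :=
    { toFun := height p θ
      map_add' := fun a b => by simp [height]; ring
      map_smul' := fun a b => by simp [height]; ring }
  have h1 : shadow (proj p '' hull x S) θ = convexHull ℝ ((fun i => height p θ (x i)) '' S) := by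
    have : shadow (proj p '' hull x S) θ = L '' hull x S := by
      rw [shadow, Set.image_image]
      exact Set.image_congr fun z _ => along_proj p θ z
    rw [this, hull, L.image_convexHull, Set.image_image]
    rfl
  rw [h1]
  apply Set.Subset.antisymm
  · apply convexHull_min _ (convex_Icc _ _)
    rintro _ ⟨i, hi', rfl⟩
    exact ⟨S.inf'_le _ hi', S.le_sup' (fun i => height p θ (x i)) hi'⟩
  · obtain ⟨i, hi1, hi2⟩ := S.exists_mem_eq_inf' hS fun i => height p θ (x i)
    obtain ⟨j, hj1, hj2⟩ := S.exists_mem_eq_sup' hS fun i => height p θ (x i)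
    have hc := (convex_convexHull ℝ ((fun i => height p θ (x i)) '' (S : Set (Fin n)))).ordConnected
    apply hc.out
    · rw [lo, hi2]; exact subset_convexHull ℝ _ ⟨i, hi1, rfl⟩
    · rw [hi, hj2]; exact subset_convexHull ℝ _ ⟨j, hj1, rfl⟩

lemma shadowLength_hull (p : Fin d × Fin d) (θ : ℝ) :
    shadowLength (proj p '' hull x S) θ = hi x hS p θ - lo x hS p θ := by
  rw [shadowLength, shadow_hull x hS, csSup_Icc (lo_le_hi x hS p θ), csInf_Icc (lo_le_hi x hS p θ)]

lemma ofReal_perimeter_hull (p : Fin d × Fin d) :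
    ENNReal.ofReal (perimeter (proj p '' hull x S)) =
      ∫⁻ θ in Set.Ioc 0 Real.pi, ENNReal.ofReal (hi x hS p θ - lo x hS p θ) := by
  rw [perimeter, intervalIntegral.integral_of_le Real.pi_pos.le]
  simp_rw [shadowLength_hull x hS]
  apply ofReal_integral_eq_lintegral_ofReal
  · exact (((continuous_hi x hS p).sub (continuous_lo x hS p)).integrableOn_Icc).mono_set
      Set.Ioc_subset_Icc_self
  · exact Eventually.of_forall fun θ => sub_nonneg.2 (lo_le_hi x hS p θ)

include hS in
lemma perimeter_hull_nonneg (p : Fin d × Fin d) : 0 ≤ perimeter (proj p '' hull x S) := by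
  rw [perimeter]
  apply intervalIntegral.integral_nonneg Real.pi_pos.le
  intro θ _
  rw [shadowLength_hull x hS]
  exact sub_nonneg.2 (lo_le_hi x hS p θ)

lemma rate_hull_empty : rate (hull x ∅) = 0 := by
  simp [rate, hull, perimeter, shadowLength, shadow]

lemma planeMeasure_apply {s : Set (Plane d)} (hs : MeasurableSet s) :
    planeMeasure d s = ∑ p ∈ pairs d, ∫⁻ θ in Set.Ioc 0 Real.pi, volume {t | (p, θ, t) ∈ s} := by
  rw [planeMeasure, Measure.prod_apply hs, lintegral_finset]
  refine Finset.sum_congr rfl fun p _ => ?_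
  rw [Measure.count_singleton, mul_one,
    Measure.prod_apply (measurable_prodMk_left hs)]
  rfl

/-- The hyperplanes splitting `S` have measure `rate (hull x S)`. -/
lemma planeMeasure_splits (S : Finset (Fin n)) :
    planeMeasure d (splits x S) = ENNReal.ofReal (rate (hull x S)) := by
  rcases S.eq_empty_or_nonempty with rfl | hS
  · simp [rate_hull_empty, splits]
  rw [planeMeasure_apply (measurableSet_splits x S), rate,
    ENNReal.ofReal_sum_of_nonneg fun p _ => perimeter_hull_nonneg x hS p]
  refine Finset.sum_congr rfl fun p _ => ?_
  rw [ofReal_perimeter_hull x hS]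
  refine lintegral_congr fun θ => ?_
  rw [← Real.volume_Ico]
  congr 1
  ext t
  exact mem_splits_iff x hS (p, θ, t)

lemma rate_hull_nonneg (S : Finset (Fin n)) : 0 ≤ rate (hull x S) := by
  rcases S.eq_empty_or_nonempty with rfl | hS
  · rw [rate_hull_empty]
  · exact Finset.sum_nonneg fun p _ => perimeter_hull_nonneg x hS p

lemma rate_hull (S : Finset (Fin n)) :
    rate (hull x S) = (planeMeasure d (splits x S)).toReal := by
  rw [planeMeasure_splits, ENNReal.toReal_ofReal (rate_hull_nonneg x S)]

lemma nonempty_of_rate_pos (h : 0 < rate (hull x S)) : S.Nonempty := by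
  rcases S.eq_empty_or_nonempty with rfl | hS
  · simp [rate_hull_empty] at h
  · exact hS

lemma ae_shadowLength_eq_zero (p : Fin d × Fin d)
    (hp : perimeter (proj p '' hull x S) = 0) :
    ∀ᵐ θ ∂(volume.restrict (Set.Ioc 0 Real.pi)), hi x hS p θ - lo x hS p θ ≤ 0 := by
  have h := ofReal_perimeter_hull x hS p
  rw [hp, ENNReal.ofReal_zero, eq_comm, lintegral_eq_zero_iff] at h
  · filter_upwards [h] with θ hθ
    simpa using hθ
  · exact ((continuous_hi x hS p).sub (continuous_lo x hS p)).measurable.ennreal_ofReal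

lemma ae_ofReal_cutDensity (h : 0 < rate (hull x S)) :
    (fun q => ENNReal.ofReal (cutDensity (hull x S) q)) =ᵐ[planeMeasure d]
      (splits x S).indicator fun _ => (ENNReal.ofReal (rate (hull x S)))⁻¹ := by
  have hS := nonempty_of_rate_pos x h
  -- The factors of `cutDensity` cancel to the inverse rate except at the upper end of the closed
  -- shadow, and where a perimeter is 0 although the width is positive, so that division by 0 makes
  -- the density 0. Both sets are null.
  let B : Set (Plane d) := {q | q.2.2 = hi x hS q.1 q.2.1} ∪
    {q | perimeter (proj q.1 '' hull x S) = 0 ∧ 0 < hi x hS q.1 q.2.1 - lo x hS q.1 q.2.1}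
  have hB1 : MeasurableSet {q : Plane d | q.2.2 = hi x hS q.1 q.2.1} :=
    measurableSet_eq_fun (by fun_prop) (measurable_hi x hS)
  have hB2 : MeasurableSet {q : Plane d | perimeter (proj q.1 '' hull x S) = 0 ∧
      0 < hi x hS q.1 q.2.1 - lo x hS q.1 q.2.1} := by
    apply MeasurableSet.inter
    · exact measurable_fst (MeasurableSet.of_discrete
        (s := {p : Fin d × Fin d | perimeter (proj p '' hull x S) = 0}))
    · exact measurableSet_lt measurable_const ((measurable_hi x hS).sub (measurable_lo x hS))
  have hB : planeMeasure d B = 0 := by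
    apply measure_union_null
    · rw [planeMeasure_apply hB1]
      simp
    · rw [planeMeasure_apply hB2]
      refine Finset.sum_eq_zero fun p _ => ?_
      by_cases hp : perimeter (proj p '' hull x S) = 0
      · rw [lintegral_congr_ae (g := fun _ => 0), lintegral_zero]
        filter_upwards [ae_shadowLength_eq_zero x hS p hp] with θ hθ
        simp [hp, not_lt.2 (sub_nonpos.1 hθ)]
      · simp [hp]
  filter_upwards [measure_eq_zero_iff_ae_notMem.1 hB] with q hq
  simp only [B, Set.mem_union, Set.mem_ofPred_eq, not_or, not_and, not_lt] at hq
  obtain ⟨hq1, hq2⟩ := hq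
  simp only [cutDensity, shadowLength_hull x hS, shadow_hull x hS, Set.indicator,
    mem_splits_iff x hS]
  have hmem : q.2.2 ∈ Set.Icc (lo x hS q.1 q.2.1) (hi x hS q.1 q.2.1) ↔
      q.2.2 ∈ Set.Ico (lo x hS q.1 q.2.1) (hi x hS q.1 q.2.1) :=
    ⟨fun h => ⟨h.1, lt_of_le_of_ne h.2 hq1⟩, fun h => ⟨h.1, h.2.le⟩⟩
  simp only [hmem]
  split_ifs with hs
  · have hl : 0 < hi x hS q.1 q.2.1 - lo x hS q.1 q.2.1 := sub_pos.2 (hs.1.trans_lt hs.2)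
    have hp : perimeter (proj q.1 '' hull x S) ≠ 0 := fun h => absurd (hq2 h) (not_le.2 hl)
    rw [← ENNReal.ofReal_inv_of_pos h]
    congr 1
    field_simp
  · simp

lemma hyperplaneLaw_hull (h : 0 < rate (hull x S)) :
    hyperplaneLaw (hull x S) =
      (ENNReal.ofReal (rate (hull x S)))⁻¹ • (planeMeasure d).restrict (splits x S) := by
  have : hyperplaneLaw (hull x S) =
      (planeMeasure d).withDensity fun q => ENNReal.ofReal (cutDensity (hull x S) q) := rfl
  rw [this, withDensity_congr_ae (ae_ofReal_cutDensity x h),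
    withDensity_indicator (measurableSet_splits x S), withDensity_const]

lemma isProbabilityMeasure_hyperplaneLaw (h : 0 < rate (hull x S)) :
    IsProbabilityMeasure (hyperplaneLaw (hull x S)) := by
  constructor
  rw [hyperplaneLaw_hull x h]
  simp [planeMeasure_splits]
  exact ENNReal.inv_mul_cancel (by simpa using h) ENNReal.ofReal_ne_top

instance [NeZero d] (S : Finset (Fin n)) : IsProbabilityMeasure (cutLaw (hull x S)) := by
  unfold cutLaw
  split_ifs with h
  · have := isProbabilityMeasure_hyperplaneLaw x h
    have := isProbabilityMeasure_expMeasure h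
    infer_instance
  · infer_instance

instance [NeZero d] : IsProbabilityMeasure (treeLaw x) := by unfold treeLaw; infer_instance

/-- Integration against the law of the first cut. -/
lemma lintegral_cutLaw [NeZero d] (h : 0 < rate (hull x S)) {f : Cut d → ℝ≥0∞}
    (hf : Measurable f) :
    ∫⁻ C, f C ∂cutLaw (hull x S) =
      ∫⁻ c in Set.Ici 0, ∫⁻ q in splits x S,
        ENNReal.ofReal (Real.exp (-(rate (hull x S) * c))) * f (c, q) ∂planeMeasure d := by
  set R := rate (hull x S) with hR
  have := isProbabilityMeasure_hyperplaneLaw x h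
  have := isProbabilityMeasure_expMeasure h
  rw [cutLaw, if_pos h, lintegral_prod _ hf.aemeasurable]
  rw [hyperplaneLaw_hull x h, ← hR]
  have hm : Measurable fun c => ∫⁻ q in splits x S, f (c, q) ∂planeMeasure d :=
    hf.lintegral_prod_right'
  simp only [lintegral_smul_measure, smul_eq_mul]
  have hg : Measurable (gammaPDF 1 R) := (measurable_gammaPDFReal 1 R).ennreal_ofReal
  rw [expMeasure, gammaMeasure, lintegral_withDensity_eq_lintegral_mul _
    hg (by fun_prop), ← lintegral_indicator measurableSet_Ici]
  refine lintegral_congr fun c => ?_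
  change exponentialPDF R c * _ = _
  rw [exponentialPDF_eq]
  by_cases hc : 0 ≤ c
  -- The factor R of the exponential density cancels the normalisation R⁻¹ of the hyperplane law.
  -- What remains is the same measure on hyperplanes for every node, which makes different nodes
  -- comparable.
  · rw [if_pos hc, Set.indicator_of_mem (show c ∈ Set.Ici (0:ℝ) from hc),
      lintegral_const_mul _ (by fun_prop), ENNReal.ofReal_mul h.le, ← mul_assoc,
      mul_right_comm (ENNReal.ofReal R), ENNReal.mul_inv_cancel (by simpa using h)
      ENNReal.ofReal_ne_top, one_mul]
  · rw [if_neg hc, Set.indicator_of_notMem (by simpa using hc)]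
    simp

/-- As the measure of a section of a jointly measurable set, the rate depends measurably on the
points; the geometry of hulls is not needed. -/
lemma measurable_rate (S : Finset (Fin n)) :
    Measurable fun x : Fin n → Feature d => rate (hull x S) := by
  simp_rw [rate_hull]
  exact (measurable_measure_prodMk_left (measurableSet_splits_prod S)).ennreal_toReal

lemma measurable_cutLaw [NeZero d] (S : Finset (Fin n)) :
    Measurable fun x : Fin n → Feature d => cutLaw (hull x S) := by
  refine Measure.measurable_of_measurable_coe _ fun s hs => ?_
  have hpos : MeasurableSet {x : Fin n → Feature d | 0 < rate (hull x S)} :=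
    measurableSet_lt measurable_const (measurable_rate S)
  have key : (fun x : Fin n → Feature d => cutLaw (hull x S) s) = fun x =>
      if 0 < rate (hull x S) then ∫⁻ c in Set.Ici 0, ∫⁻ q,
        (splits x S).indicator (fun q => ENNReal.ofReal (Real.exp (-(rate (hull x S) * c))) *
          s.indicator 1 (c, q)) q ∂planeMeasure d
      else Measure.dirac 0 s := by
    funext x
    split_ifs with h
    · rw [← lintegral_indicator_one hs, lintegral_cutLaw x h (measurable_one.indicator hs)]
      refine lintegral_congr fun c => ?_
      rw [lintegral_indicator (measurableSet_splits x S)]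
    · rw [cutLaw, if_neg h]
  rw [key]
  refine Measurable.ite hpos ?_ measurable_const
  refine Measurable.lintegral_prod_right ?_
  refine Measurable.lintegral_prod_right ?_
  have : MeasurableSet {a : ((Fin n → Feature d) × ℝ) × Plane d | a.2 ∈ splits a.1.1 S} :=
    (measurableSet_splits_prod S).preimage
      (f := fun a : ((Fin n → Feature d) × ℝ) × Plane d => (a.1.1, a.2)) (by fun_prop)
  have hR := measurable_rate (d := d) S
  refine Measurable.indicator (s := {a : ((Fin n → Feature d) × ℝ) × Plane d | a.2 ∈ splits a.1.1 S})
    (f := fun a => ENNReal.ofReal (Real.exp (-(rate (hull a.1.1 S) * a.1.2))) *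
          s.indicator 1 (a.1.2, a.2)) ?_ this
  refine Measurable.mul ?_ ?_
  · have : Measurable fun a : ((Fin n → Feature d) × ℝ) × Plane d => rate (hull a.1.1 S) :=
      hR.comp (by fun_prop)
    fun_prop
  · exact (measurable_one.indicator hs).comp (by fun_prop)

lemma measurable_treeLaw [NeZero d] :
    Measurable fun x : Fin n → Feature d => treeLaw x := by
  refine Measurable.measure_of_isPiSystem_of_isProbabilityMeasure generateFrom_pi.symm
    isPiSystem_pi ?_
  rintro _ ⟨s, hs, rfl⟩
  simp only [treeLaw, Measure.pi_pi]
  refine Finset.measurable_prod _ fun S _ => ?_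
  have hS : MeasurableSet (s S) := hs S (Set.mem_univ _)
  exact (Measure.measurable_coe hS).comp (measurable_cutLaw S)

end Hull

/-- The law of the randomness of a tree as a Markov kernel. -/
def treeKernel (d n : ℕ) [NeZero d] : Kernel (Fin n → Feature d) (Finset (Fin n) → Cut d) :=
  ⟨treeLaw, measurable_treeLaw⟩

instance {d n : ℕ} [NeZero d] : IsMarkovKernel (treeKernel d n) :=
  ⟨fun x => inferInstanceAs (IsProbabilityMeasure (treeLaw x))⟩

end

end BSPForest

/-! ### The leaf of a point and its renewal equation -/

namespace BSPForest

noncomputable section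

open scoped Classical ENNReal

/-- The points of `S` on the same side of the hyperplane `q` as `z`. -/
def side {d : ℕ} {ι : Type*} (x : ι → Feature d) (q : Plane d) (z : Feature d) (S : Finset ι) :
    Finset ι := S.filter fun i => (q.IsLeft (x i) ↔ q.IsLeft z)

lemma side_subset {d : ℕ} {ι : Type*} (x : ι → Feature d) (q : Plane d) (z : Feature d)
    (S : Finset ι) : side x q z S ⊆ S := Finset.filter_subset _ _

lemma card_side_lt {d : ℕ} {ι : Type*} {x : ι → Feature d} {q : Plane d} (z : Feature d)
    {S : Finset ι} (h : q ∈ splits x S) : (side x q z S).card < S.card := by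
  obtain ⟨⟨i, hi, hi'⟩, j, hj, hj'⟩ := h
  apply Finset.card_lt_card
  by_cases hz : q.IsLeft z
  · exact Finset.filter_ssubset.2 ⟨j, hj, by simp [hz, hj']⟩
  · exact Finset.filter_ssubset.2 ⟨i, hi, by simp [hz, hi']⟩

/-- The data points in the leaf of `z` in the tree grown on `S`. -/
def leafAt {d n : ℕ} (r : ℕ) (x : Fin n → Feature d) (ω : Finset (Fin n) → Cut d) (τ : ℝ)
    (S : Finset (Fin n)) (z : Feature d) : Finset (Fin n) := (hullCut r x ω τ S).leafOf z

section LeafAt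

variable {d n : ℕ} (r : ℕ) (x : Fin n → Feature d) (ω : Finset (Fin n) → Cut d) (τ : ℝ)
    (S : Finset (Fin n)) (z : Feature d)

lemma parts_lt_iff (C : Cut d) :
    (leftPart x C S).card < S.card ∧ (rightPart x C S).card < S.card ↔ C.2 ∈ splits x S := by
  have h1 : (leftPart x C S).card < S.card ↔ ∃ i ∈ S, ¬ Plane.IsLeft C.2 (x i) := by
    simp only [leftPart, (Finset.card_filter_le _ _).lt_iff_ne, ne_eq, Finset.card_filter_eq_iff,
      Cut.isLeft_iff]
    push Not
    rfl
  have h2 : (rightPart x C S).card < S.card ↔ ∃ i ∈ S, Plane.IsLeft C.2 (x i) := by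
    simp only [rightPart, (Finset.card_filter_le _ _).lt_iff_ne, ne_eq, Finset.card_filter_eq_iff,
      Cut.isLeft_iff]
    push Not
    rfl
  rw [h1, h2, and_comm]
  rfl

/-- Only the nodes on the path of `z` matter, so the recursion over the tree becomes a recursion
along one path, suited to induction on `S.card`. -/
lemma leafAt_eq : leafAt r x ω τ S z =
    if r < S.card ∧ 0 < rate (hull x S) ∧ (ω S).cost < τ ∧ (ω S).2 ∈ splits x S then
      leafAt r x ω (τ - (ω S).cost) (side x (ω S).2 z S) z else S := by
  rw [leafAt, hullCut]
  by_cases h1 : r < S.card ∧ 0 < rate (hull x S) ∧ (ω S).cost < τ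
  · by_cases h2 : (ω S).2 ∈ splits x S
    · have h2' := (parts_lt_iff x S (ω S)).2 h2
      rw [if_pos h1, dif_pos h2', if_pos ⟨h1.1, h1.2.1, h1.2.2, h2⟩, Tree.leafOf, leafAt]
      by_cases hz : (ω S).IsLeft z
      · rw [if_pos hz]
        rw [Cut.isLeft_iff] at hz
        congr 2
        ext i
        simp [leftPart, side, hz, Cut.isLeft_iff]
      · rw [if_neg hz]
        rw [Cut.isLeft_iff] at hz
        congr 2
        ext i
        simp [rightPart, side, hz, Cut.isLeft_iff]
    · rw [if_pos h1, dif_neg (fun h => h2 ((parts_lt_iff x S (ω S)).1 h)),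
        if_neg (fun h => h2 h.2.2.2), Tree.leafOf]
  · rw [if_neg h1, if_neg (fun h => h1 ⟨h.1, h.2.1, h.2.2.1⟩), Tree.leafOf]

lemma leafAt_subset : leafAt r x ω τ S z ⊆ S := by
  induction hk : S.card using Nat.strong_induction_on generalizing S τ with
  | _ k ih =>
    rw [leafAt_eq]
    split_ifs with h
    · exact (ih _ (hk ▸ card_side_lt z h.2.2.2) _ _ rfl).trans (side_subset _ _ _ _)
    · exact subset_rfl

/-- All nodes below `S` are subsets of `S`. This makes what happens after a cut independent of that
cut's own coordinate of `ω`. -/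
lemma leafAt_congr {ω ω' : Finset (Fin n) → Cut d} (h : ∀ T ⊆ S, ω T = ω' T) :
    leafAt r x ω τ S z = leafAt r x ω' τ S z := by
  induction hk : S.card using Nat.strong_induction_on generalizing S τ with
  | _ k ih =>
    rw [leafAt_eq, leafAt_eq r x ω', h S subset_rfl]
    split_ifs with h'
    · exact ih _ (hk ▸ card_side_lt z h'.2.2.2) _ _
        (fun T hT => h T (hT.trans (side_subset _ _ _ _))) rfl
    · rfl

/-- Not cutting small blocks does not change the large leaves. -/
lemma leafAt_eq_of_lt_card (h : r < (leafAt 0 x ω τ S z).card) :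
    leafAt r x ω τ S z = leafAt 0 x ω τ S z := by
  induction hk : S.card using Nat.strong_induction_on generalizing S τ with
  | _ k ih =>
    have hS : r < S.card := h.trans_le (Finset.card_le_card (leafAt_subset _ _ _ _ _ _))
    rw [leafAt_eq] at h
    rw [leafAt_eq, leafAt_eq 0]
    by_cases hc : 0 < rate (hull x S) ∧ (ω S).cost < τ ∧ (ω S).2 ∈ splits x S
    · rw [if_pos ⟨by omega, hc⟩] at h
      rw [if_pos ⟨hS, hc⟩, if_pos ⟨by omega, hc⟩]
      exact ih _ (hk ▸ card_side_lt z hc.2.2) _ _ h rfl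
    · rw [if_neg (fun h => hc h.2), if_neg (fun h => hc h.2)]

end LeafAt

/-- Leaves and sides take finitely many values, so measurability of a functional of them can be
checked with the value held fixed. -/
lemma measurable_of_finite_index {α β ι : Type*} [MeasurableSpace α] [MeasurableSpace β]
    [Countable ι] {g : α → ι} {F : ι → α → β} (hg : ∀ i, MeasurableSet {a | g a = i})
    (hF : ∀ i, Measurable (F i)) : Measurable fun a => F (g a) a := by
  let _ : MeasurableSpace ι := ⊤
  have hg' : Measurable g := measurable_to_countable' fun i => hg i
  have h : Measurable fun b : ι × α => F b.1 b.2 := measurable_from_prod_countable_right hF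
  exact h.comp (hg'.prodMk measurable_id)

section Measurability

variable {d n : ℕ}

lemma measurableSet_side_eq (S T : Finset (Fin n)) :
    MeasurableSet {a : (Fin n → Feature d) × Plane d × Feature d |
      side a.1 a.2.1 a.2.2 S = T} := by
  have h (i : Fin n) : MeasurableSet {a : (Fin n → Feature d) × Plane d × Feature d |
      (a.2.1.IsLeft (a.1 i) ↔ a.2.1.IsLeft a.2.2)} :=
    MeasurableSet.iff (measurableSet_isLeft (by fun_prop) (by fun_prop))
      (measurableSet_isLeft (by fun_prop) (by fun_prop))
  have : {a : (Fin n → Feature d) × Plane d × Feature d | side a.1 a.2.1 a.2.2 S = T} =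
      ⋂ i, {a | (i ∈ S ∧ (a.2.1.IsLeft (a.1 i) ↔ a.2.1.IsLeft a.2.2)) ↔ i ∈ T} := by
    ext a
    simp [side, Finset.ext_iff]
  rw [this]
  exact MeasurableSet.iInter fun i =>
    MeasurableSet.iff ((MeasurableSet.const _).inter (h i)) (MeasurableSet.const _)

lemma measurable_cost : Measurable (Cut.cost : Cut d → ℝ) := measurable_fst

lemma measurableSet_leafAt_eq (r : ℕ) (S A : Finset (Fin n)) :
    MeasurableSet {a : (Fin n → Feature d) × (Finset (Fin n) → Cut d) × ℝ × Feature d |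
      leafAt r a.1 a.2.1 a.2.2.1 S a.2.2.2 = A} := by
  induction hk : S.card using Nat.strong_induction_on generalizing S with
  | _ k ih =>
    let E := (Fin n → Feature d) × (Finset (Fin n) → Cut d) × ℝ × Feature d
    let c : Set E := {a | r < S.card ∧ 0 < rate (hull a.1 S) ∧ (a.2.1 S).cost < a.2.2.1 ∧
      (a.2.1 S).2 ∈ splits a.1 S}
    have hc : MeasurableSet c := by
      refine (MeasurableSet.const _).inter (MeasurableSet.inter ?_ (MeasurableSet.inter ?_ ?_))
      · exact measurableSet_lt measurable_const ((measurable_rate S).comp measurable_fst)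
      · exact measurableSet_lt (measurable_cost.comp (by fun_prop)) (by fun_prop)
      · exact (measurableSet_splits_prod S).preimage
          (f := fun a : E => (a.1, (a.2.1 S).2)) (by fun_prop)
    have : {a : E | leafAt r a.1 a.2.1 a.2.2.1 S a.2.2.2 = A} =
        (⋃ T : {T : Finset (Fin n) // T.card < S.card},
          c ∩ {a | side a.1 (a.2.1 S).2 a.2.2.2 S = T} ∩
            {a | leafAt r a.1 a.2.1 (a.2.2.1 - (a.2.1 S).cost) T a.2.2.2 = A}) ∪
        (cᶜ ∩ {_a | S = A}) := by
      ext a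
      simp only [Set.mem_ofPred_eq, Set.mem_union, Set.mem_iUnion, Set.mem_inter_iff,
        Set.mem_compl_iff]
      rw [leafAt_eq]
      by_cases ha : a ∈ c
      · rw [if_pos (show r < S.card ∧ 0 < rate (hull a.1 S) ∧ (a.2.1 S).cost < a.2.2.1 ∧
          (a.2.1 S).2 ∈ splits a.1 S from ha)]
        constructor
        · exact fun h => Or.inl ⟨⟨_, card_side_lt a.2.2.2 ha.2.2.2⟩, ⟨ha, rfl⟩, h⟩
        · rintro (⟨T, ⟨-, hT⟩, h⟩ | h)
          · rwa [hT]
          · exact absurd ha h.1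
      · rw [if_neg (show ¬ (r < S.card ∧ 0 < rate (hull a.1 S) ∧ (a.2.1 S).cost < a.2.2.1 ∧
          (a.2.1 S).2 ∈ splits a.1 S) from ha)]
        constructor
        · exact fun h => Or.inr ⟨ha, h⟩
        · rintro (⟨T, ⟨h, -⟩, -⟩ | h)
          · exact absurd h ha
          · exact h.2
    rw [this]
    refine (MeasurableSet.iUnion fun T => (hc.inter ?_).inter ?_).union
      (hc.compl.inter (MeasurableSet.const _))
    · exact (measurableSet_side_eq S T).preimage
        (f := fun a : E => (a.1, (a.2.1 S).2, a.2.2.2)) (by fun_prop)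
    · refine (ih _ (hk ▸ T.2) T rfl).preimage
        (f := fun a : E => (a.1, a.2.1, a.2.2.1 - (a.2.1 S).cost, a.2.2.2)) ?_
      have := (measurable_cost (d := d)).comp
        (show Measurable fun a : E => a.2.1 S by fun_prop)
      have h2 : Measurable fun a : E => a.2.2.1 - (a.2.1 S).cost :=
        (show Measurable fun a : E => a.2.2.1 by fun_prop).sub this
      fun_prop

end Measurability

/-- The expectation of `Φ` of the set of data points in the leaf of `z`, for a tree grown on `S`
without size restriction. -/
def leafMean {d n : ℕ} [NeZero d] (x : Fin n → Feature d) (z : Feature d)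
    (Φ : Finset (Fin n) → ℝ≥0∞) (S : Finset (Fin n)) (τ : ℝ) : ℝ≥0∞ :=
  ∫⁻ ω, Φ (leafAt 0 x ω τ S z) ∂treeLaw x

section LeafMean

variable {d n : ℕ} [NeZero d]

lemma measurable_leafMean (S : Finset (Fin n)) {Φ : (Fin n → Feature d) → Feature d →
    Finset (Fin n) → ℝ≥0∞} (hΦ : ∀ A, Measurable fun a : (Fin n → Feature d) × Feature d =>
      Φ a.1 a.2 A) :
    Measurable fun a : (Fin n → Feature d) × ℝ × Feature d =>
      leafMean a.1 a.2.2 (Φ a.1 a.2.2) S a.2.1 := by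
  have h : Measurable fun b : ((Fin n → Feature d) × ℝ × Feature d) × (Finset (Fin n) → Cut d) =>
      Φ b.1.1 b.1.2.2 (leafAt 0 b.1.1 b.2 b.1.2.1 S b.1.2.2) := by
    refine measurable_of_finite_index
      (F := fun A (b : ((Fin n → Feature d) × ℝ × Feature d) × (Finset (Fin n) → Cut d)) =>
        Φ b.1.1 b.1.2.2 A)
      (g := fun b => leafAt 0 b.1.1 b.2 b.1.2.1 S b.1.2.2) ?_ ?_
    · intro A
      exact (measurableSet_leafAt_eq 0 S A).preimage
        (f := fun b : ((Fin n → Feature d) × ℝ × Feature d) × (Finset (Fin n) → Cut d) =>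
          (b.1.1, b.2, b.1.2.1, b.1.2.2)) (by fun_prop)
    · exact fun A => (hΦ A).comp (g := fun a : (Fin n → Feature d) × Feature d => Φ a.1 a.2 A)
        (f := fun b : ((Fin n → Feature d) × ℝ × Feature d) × (Finset (Fin n) → Cut d) =>
          (b.1.1, b.1.2.2)) (by fun_prop)
  exact h.lintegral_kernel_prod_right' (κ := (treeKernel d n).comap
    (fun a : (Fin n → Feature d) × ℝ × Feature d => a.1) measurable_fst)

/-- By `hS` the second argument of `G` enters only through the coordinates other than `S`, which are
independent of `ω S`; the latter can be integrated out separately. -/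
lemma lintegral_treeLaw_update (x : Fin n → Feature d) (S : Finset (Fin n))
    {G : Cut d → (Finset (Fin n) → Cut d) → ℝ≥0∞}
    (hG : Measurable fun a : Cut d × (Finset (Fin n) → Cut d) => G a.1 a.2)
    (hS : ∀ C ω C', G C (Function.update ω S C') = G C ω) :
    ∫⁻ ω, G (ω S) ω ∂treeLaw x = ∫⁻ C, ∫⁻ ω, G C ω ∂treeLaw x ∂cutLaw (hull x S) := by
  rw [lintegral_lintegral_swap hG.aemeasurable]
  have hm : Measurable fun ω => ∫⁻ C, G C ω ∂cutLaw (hull x S) := hG.lintegral_prod_left'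
  refine lintegral_eq_of_lmarginal_eq {S} (hG.comp (by fun_prop : Measurable
    fun ω : Finset (Fin n) → Cut d => (ω S, ω))) hm ?_
  rw [lmarginal_singleton, lmarginal_singleton]
  funext ω
  simp [hS]

lemma lintegral_Ici_exp {R : ℝ} (hR : 0 < R) (τ : ℝ) :
    ∫⁻ c in Set.Ici τ, ENNReal.ofReal (Real.exp (-(R * c))) * ENNReal.ofReal R =
      ENNReal.ofReal (Real.exp (-(R * τ))) := by
  have h1 := integrableOn_exp_mul_Ioi (neg_lt_zero.2 hR) τ
  have h2 := integral_exp_mul_Ioi (neg_lt_zero.2 hR) τ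
  simp only [neg_mul] at h1 h2
  rw [lintegral_mul_const _ (by fun_prop), setLIntegral_congr Ioi_ae_eq_Ici.symm,
    ← ofReal_integral_eq_lintegral_ofReal h1 (Eventually.of_forall fun c => (Real.exp_pos _).le),
    h2, ← ENNReal.ofReal_mul' hR.le]
  congr 1
  field_simp

lemma leafMean_of_not_splits (x : Fin n → Feature d) (z : Feature d) (Φ : Finset (Fin n) → ℝ≥0∞)
    {S : Finset (Fin n)} (h : rate (hull x S) = 0) (τ : ℝ) : leafMean x z Φ S τ = Φ S := by
  simp only [leafMean]
  have (ω : Finset (Fin n) → Cut d) : leafAt 0 x ω τ S z = S := by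
    rw [leafAt_eq, if_neg]; simp [h]
  simp [this]

/-- The expectation over a tree, conditioned on the first cut. -/
lemma leafMean_eq (x : Fin n → Feature d) (z : Feature d) (Φ : Finset (Fin n) → ℝ≥0∞)
    (S : Finset (Fin n)) {τ : ℝ} (hτ : 0 < τ) :
    leafMean x z Φ S τ = ENNReal.ofReal (Real.exp (-(rate (hull x S) * τ))) * Φ S +
      ∫⁻ c in Set.Ioo 0 τ, ∫⁻ q in splits x S,
        ENNReal.ofReal (Real.exp (-(rate (hull x S) * c))) *
          leafMean x z Φ (side x q z S) (τ - c) ∂planeMeasure d := by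
  rcases (rate_hull_nonneg x S).eq_or_lt with h0 | hR
  · have : (planeMeasure d).restrict (splits x S) = 0 := by
      rw [Measure.restrict_eq_zero, planeMeasure_splits, ← h0, ENNReal.ofReal_zero]
    simp [this, leafMean_of_not_splits x z Φ h0.symm, ← h0]
  set R := rate (hull x S) with hRdef
  -- Testing `C.2 ∈ splits x S` ensures that the child is a proper subset of `S`, so that `ω S` is
  -- not used again below it.
  let G : Cut d → (Finset (Fin n) → Cut d) → ℝ≥0∞ := fun C ω =>
    if C.1 < τ ∧ C.2 ∈ splits x S then Φ (leafAt 0 x ω (τ - C.1) (side x C.2 z S) z) else Φ S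
  have hc : MeasurableSet {a : Cut d | a.1 < τ ∧ a.2 ∈ splits x S} :=
    (measurableSet_lt measurable_fst measurable_const).inter
      ((measurableSet_splits x S).preimage measurable_snd)
  have hG : Measurable fun a : Cut d × (Finset (Fin n) → Cut d) => G a.1 a.2 := by
    refine Measurable.ite (hc.preimage measurable_fst) ?_ measurable_const
    refine measurable_of_finite_index
      (F := fun T (a : Cut d × (Finset (Fin n) → Cut d)) => Φ (leafAt 0 x a.2 (τ - a.1.1) T z))
      (g := fun a => side x a.1.2 z S) ?_ ?_
    · intro T
      exact (measurableSet_side_eq S T).preimage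
        (f := fun a : Cut d × (Finset (Fin n) → Cut d) => (x, a.1.2, z)) (by fun_prop)
    · intro T
      refine measurable_of_finite_index
        (F := fun A (_ : Cut d × (Finset (Fin n) → Cut d)) => Φ A)
        (g := fun a => leafAt 0 x a.2 (τ - a.1.1) T z) ?_ fun _ => measurable_const
      intro A
      exact (measurableSet_leafAt_eq 0 T A).preimage
        (f := fun a : Cut d × (Finset (Fin n) → Cut d) => (x, a.2, τ - a.1.1, z)) (by fun_prop)
  have hS : ∀ C ω C', G C (Function.update ω S C') = G C ω := by
    intro C ω C'
    simp only [G]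
    split_ifs with h
    · congr 1
      apply leafAt_congr
      intro T hT
      rw [Function.update_of_ne]
      rintro rfl
      exact absurd (Finset.card_le_card hT) (not_le.2 (card_side_lt z h.2))
    · rfl
  have hint : ∀ C, ∫⁻ ω, G C ω ∂treeLaw x = if C.1 < τ ∧ C.2 ∈ splits x S then
      leafMean x z Φ (side x C.2 z S) (τ - C.1) else Φ S := by
    intro C
    simp only [G]
    split_ifs with h
    · rfl
    · simp
  have h1 : leafMean x z Φ S τ = ∫⁻ ω, G (ω S) ω ∂treeLaw x := by
    refine lintegral_congr fun ω => ?_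
    rw [leafAt_eq]
    simp only [G, ← hRdef, hR, (nonempty_of_rate_pos x hR).card_pos, true_and]
    exact apply_ite Φ _ _ _
  rw [h1, lintegral_treeLaw_update x S hG hS, lintegral_cutLaw x hR hG.lintegral_prod_right']
  have hIci : Set.Ici (0:ℝ) = Set.Ico 0 τ ∪ Set.Ici τ := (Set.Ico_union_Ici_eq_Ici hτ.le).symm
  rw [← hRdef, hIci, lintegral_union measurableSet_Ici
    (Set.disjoint_left.2 fun a ha hb => absurd ha.2 (not_lt.2 hb)), add_comm]
  congr 1
  -- A cost of at least τ leaves the node uncut; integrating the constant over the splitting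
  -- hyperplanes restores the factor R of the exponential density.
  · rw [← lintegral_Ici_exp hR τ, ← lintegral_mul_const _ (by fun_prop)]
    refine setLIntegral_congr_fun measurableSet_Ici fun c hc' => ?_
    have : ∀ q : Plane d, ∫⁻ ω, G (c, q) ω ∂treeLaw x = Φ S := fun q => by
      rw [hint, if_neg (fun h => absurd h.1 (not_lt.2 hc'))]
    simp only [this, lintegral_const, Measure.restrict_apply_univ, planeMeasure_splits, ← hRdef]
    ring
  · rw [setLIntegral_congr Ioo_ae_eq_Ico.symm]
    refine setLIntegral_congr_fun measurableSet_Ioo fun c hc' => ?_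
    refine setLIntegral_congr_fun (measurableSet_splits x S) fun q hq => ?_
    simp only
    rw [hint, if_pos ⟨hc'.2, hq⟩]

end LeafMean

end

end BSPForest

/-! ### Exponential bounds from the renewal equation -/

namespace BSPForest

noncomputable section

open scoped Classical ENNReal

section Growth

/-- The function exp(κτ) solves exactly the renewal equation in which the first cut comes at rate R
and the mass after it has total weight R + κ. The integrand has the antiderivative -exp(κτ -
(R+κ)c). -/
lemma exp_renewal {R κ τ : ℝ} (hR : 0 ≤ R + κ) (hτ : 0 < τ) :
    ENNReal.ofReal (Real.exp (-(R * τ))) + ∫⁻ c in Set.Ioo 0 τ,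
      ENNReal.ofReal (Real.exp (-(R * c))) *
        (ENNReal.ofReal (R + κ) * ENNReal.ofReal (Real.exp (κ * (τ - c)))) =
    ENNReal.ofReal (Real.exp (κ * τ)) := by
  have h1 : ∀ c, ENNReal.ofReal (Real.exp (-(R * c))) *
        (ENNReal.ofReal (R + κ) * ENNReal.ofReal (Real.exp (κ * (τ - c)))) =
      ENNReal.ofReal (Real.exp (-(R * c)) * ((R + κ) * Real.exp (κ * (τ - c)))) := fun c => by
    rw [ENNReal.ofReal_mul (by positivity), ENNReal.ofReal_mul hR]
  have hcont : Continuous fun c : ℝ =>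
      Real.exp (-(R * c)) * ((R + κ) * Real.exp (κ * (τ - c))) := by fun_prop
  have hd : ∀ c : ℝ, HasDerivAt (fun c => -Real.exp (κ * τ - (R + κ) * c))
      (Real.exp (-(R * c)) * ((R + κ) * Real.exp (κ * (τ - c)))) c := by
    intro c
    have h := ((((hasDerivAt_id c).const_mul (R + κ)).const_sub (κ * τ)).exp).neg
    refine h.congr_deriv ?_
    rw [mul_left_comm, ← Real.exp_add, id, mul_one, mul_neg, neg_neg, mul_comm]
    ring_nf
  have hi := intervalIntegral.integral_eq_sub_of_hasDerivAt (a := 0) (b := τ)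
    (fun c _ => hd c) (hcont.intervalIntegrable 0 τ)
  simp_rw [h1]
  rw [setLIntegral_congr Ioo_ae_eq_Ioc, ← ofReal_integral_eq_lintegral_ofReal
    (hcont.integrableOn_Icc.mono_set Set.Ioc_subset_Icc_self)
    (Eventually.of_forall fun c => by positivity), ← intervalIntegral.integral_of_le hτ.le, hi,
    ← ENNReal.ofReal_add (Real.exp_pos _).le]
  · congr 1
    ring_nf
  · rw [sub_nonneg, neg_le_neg_iff, Real.exp_le_exp]
    nlinarith

/-- If the mass after a cut grows at most at rate `κ` then it is at most exponential. -/
lemma growth_bound {d : ℕ} {A : Set (Plane d)} {f B : ℝ≥0∞} {h : ℝ → Plane d → ℝ≥0∞}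
    {R κ τ : ℝ} (hR : 0 ≤ R + κ) (hτ : 0 < τ) (hf : f ≤ B)
    (hh : ∀ c ∈ Set.Ioo 0 τ, ∫⁻ q in A, h c q ∂planeMeasure d ≤
      ENNReal.ofReal (R + κ) * ENNReal.ofReal (Real.exp (κ * (τ - c))) * B) :
    ENNReal.ofReal (Real.exp (-(R * τ))) * f + ∫⁻ c in Set.Ioo 0 τ, ∫⁻ q in A,
      ENNReal.ofReal (Real.exp (-(R * c))) * h c q ∂planeMeasure d ≤
    ENNReal.ofReal (Real.exp (κ * τ)) * B := by
  rw [← exp_renewal hR hτ, add_mul, ← lintegral_mul_const _ (by fun_prop)]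
  gcongr ?_ + ?_
  · gcongr
  · refine setLIntegral_mono' measurableSet_Ioo fun c hc => ?_
    rw [lintegral_const_mul' _ _ ENNReal.ofReal_ne_top, mul_assoc]
    gcongr
    exact hh c hc

/-- The lower integral is superadditive without measurability; this direction suffices and avoids
measurability of `leafMean` in the cut. -/
lemma sum_lintegral_le {α ι : Type*} [MeasurableSpace α] (μ : Measure α) (s : Finset ι)
    (f : ι → α → ℝ≥0∞) : ∑ i ∈ s, ∫⁻ a, f i a ∂μ ≤ ∫⁻ a, ∑ i ∈ s, f i a ∂μ := by
  induction s using Finset.induction_on with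
  | empty => simp
  | insert i s hi ih =>
    simp only [Finset.sum_insert hi]
    exact (add_le_add_right ih _).trans (le_lintegral_add _ _)

end Growth

section Relabel

variable {d n m : ℕ}

lemma splits_map {ι κ : Type*} (x : κ → Feature d) (e : ι ↪ κ) (S : Finset ι) :
    splits x (S.map e) = splits (x ∘ e) S := by
  ext q
  simp [splits]

lemma side_map {ι κ : Type*} (x : κ → Feature d) (e : ι ↪ κ) (q : Plane d) (z : Feature d)
    (S : Finset ι) : side x q z (S.map e) = (side (x ∘ e) q z S).map e := by
  simp only [side, Finset.filter_map]
  rfl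

/-- The renewal equation sees only the points and not their names. It is needed to embed a sample of
size n into one of size n+1, and to permute a sample. -/
lemma leafMean_map [NeZero d] (x : Fin m → Feature d) (e : Fin n ↪ Fin m) (z : Feature d)
    (Φ : Finset (Fin m) → ℝ≥0∞) (S : Finset (Fin n)) {τ : ℝ} (hτ : 0 < τ) :
    leafMean x z Φ (S.map e) τ = leafMean (x ∘ e) z (fun A => Φ (A.map e)) S τ := by
  induction hk : S.card using Nat.strong_induction_on generalizing S τ with
  | _ k ih =>
    rw [leafMean_eq x z Φ _ hτ, leafMean_eq (x ∘ e) z _ S hτ, rate_hull, rate_hull, splits_map]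
    congr 1
    refine setLIntegral_congr_fun measurableSet_Ioo fun c hc => ?_
    refine setLIntegral_congr_fun (measurableSet_splits _ S) fun q hq => ?_
    rw [side_map, ih _ (hk ▸ card_side_lt z hq) _ (sub_pos.2 hc.2) rfl]

end Relabel

/-! ### Adding the query point to the sample -/

section Compare

variable {d n : ℕ}

lemma splits_mono {ι : Type*} (x : ι → Feature d) {S T : Finset ι} (h : S ⊆ T) :
    splits x S ⊆ splits x T := by
  rintro q ⟨⟨i, hi, hi'⟩, j, hj, hj'⟩
  exact ⟨⟨i, h hi, hi'⟩, j, h hj, hj'⟩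

lemma planeMeasure_splits_ne_top (x : Fin n → Feature d) (S : Finset (Fin n)) :
    planeMeasure d (splits x S) ≠ ∞ := by
  rw [planeMeasure_splits]; exact ENNReal.ofReal_ne_top

lemma rate_hull_mono (x : Fin n → Feature d) {S T : Finset (Fin n)} (h : S ⊆ T) :
    rate (hull x S) ≤ rate (hull x T) := by
  rw [rate_hull, rate_hull]
  exact ENNReal.toReal_mono (planeMeasure_splits_ne_top x T) (measure_mono (splits_mono x h))

lemma rate_hull_singleton (x : Fin n → Feature d) (j : Fin n) : rate (hull x {j}) = 0 := by
  rw [rate_hull]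
  have : splits x {j} = ∅ := by
    ext q; simp [splits]
  simp [this]

lemma measurable_leafAt_fun (x : Fin n → Feature d) (z : Feature d) (Φ : Finset (Fin n) → ℝ≥0∞)
    (S : Finset (Fin n)) (τ : ℝ) : Measurable fun ω => Φ (leafAt 0 x ω τ S z) := by
  refine measurable_of_finite_index (F := fun A (_ : Finset (Fin n) → Cut d) => Φ A)
    (g := fun ω => leafAt 0 x ω τ S z) ?_ fun _ => measurable_const
  intro A
  exact (measurableSet_leafAt_eq 0 S A).preimage
    (f := fun ω : Finset (Fin n) → Cut d => (x, ω, τ, z)) (by fun_prop)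

variable [NeZero d]

/-- Compared to the tree grown on one more point `x j`, the leaf of `x j` in the tree grown on `S`
is only larger in law, as long as `x j` does not get isolated. -/
lemma leafMean_insert_le (x : Fin n → Feature d) {j : Fin n} (Φ : Finset (Fin n) → ℝ≥0∞)
    {S : Finset (Fin n)} (hj : j ∉ S) {τ : ℝ} (hτ : 0 < τ) :
    leafMean x (x j) (fun A => if A = {j} then 0 else Φ (A.erase j)) (insert j S) τ ≤
      leafMean x (x j) Φ S τ := by
  induction hk : S.card using Nat.strong_induction_on generalizing S τ with
  | _ k ih =>
    have hR := rate_hull_mono x (Finset.subset_insert j S)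
    rw [leafMean_eq _ _ _ _ hτ, leafMean_eq _ _ _ S hτ]
    -- The enlarged node has the larger rate, so its survival factors exp(-Rc) are smaller in both
    -- terms.
    gcongr ?_ + ?_
    · gcongr ?_ * ?_
      · gcongr
      · rw [Finset.erase_insert hj]
        split_ifs <;> simp
    · refine setLIntegral_mono' measurableSet_Ioo fun c hc => ?_
      rw [← lintegral_indicator (measurableSet_splits _ _),
        ← lintegral_indicator (measurableSet_splits _ _)]
      refine lintegral_mono fun q => ?_
      by_cases hq : q ∈ splits x S
      · rw [Set.indicator_of_mem hq,
          Set.indicator_of_mem (splits_mono x (Finset.subset_insert j S) hq)]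
        have hs : side x q (x j) (insert j S) = insert j (side x q (x j) S) := by
          simp [side, Finset.filter_insert]
        rw [hs]
        have hc0 := hc.1.le
        gcongr ?_ * ?_
        · gcongr
        · exact ih _ (hk ▸ card_side_lt _ hq) (fun h => hj (side_subset _ _ _ _ h))
            (sub_pos.2 hc.2) rfl
      · by_cases hq' : q ∈ splits x (insert j S)
        -- A hyperplane that splits `insert j S` but not `S` isolates `x j`, and there the
        -- functional on the left is 0.
        · have hs : side x q (x j) (insert j S) = {j} := by
            ext i
            simp only [side, Finset.mem_filter, Finset.mem_insert, Finset.mem_singleton]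
            constructor
            · rintro ⟨rfl | hi, h⟩
              · rfl
              exfalso
              apply hq
              simp only [splits, Finset.mem_insert, Set.mem_ofPred_eq, exists_eq_or_imp] at hq' ⊢
              by_cases hl : q.IsLeft (x j)
              · exact ⟨⟨i, hi, h.2 hl⟩, hq'.2.resolve_left (not_not.2 hl)⟩
              · exact ⟨hq'.1.resolve_left hl, i, hi, fun h' => hl (h.1 h')⟩
            · rintro rfl
              exact ⟨Or.inl rfl, Iff.rfl⟩
          rw [Set.indicator_of_mem hq', hs, leafMean_of_not_splits _ _ _ (rate_hull_singleton x j)]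
          simp
        · rw [Set.indicator_of_notMem hq']
          exact zero_le

lemma leafMean_mono (x : Fin n → Feature d) (z : Feature d) {Φ Ψ : Finset (Fin n) → ℝ≥0∞}
    {S : Finset (Fin n)} {τ : ℝ} (h : ∀ A ⊆ S, Φ A ≤ Ψ A) :
    leafMean x z Φ S τ ≤ leafMean x z Ψ S τ :=
  lintegral_mono fun _ => h _ (leafAt_subset _ _ _ _ _ _)

lemma leafMean_add (x : Fin n → Feature d) (z : Feature d) (Φ Ψ : Finset (Fin n) → ℝ≥0∞)
    (S : Finset (Fin n)) (τ : ℝ) :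
    leafMean x z (fun A => Φ A + Ψ A) S τ = leafMean x z Φ S τ + leafMean x z Ψ S τ :=
  lintegral_add_left (measurable_leafAt_fun x z Φ S τ) _

lemma leafMean_const (x : Fin n → Feature d) (z : Feature d) (a : ℝ≥0∞)
    (S : Finset (Fin n)) (τ : ℝ) : leafMean x z (fun _ => a) S τ = a := by
  simp [leafMean]

lemma leafMean_const_mul (x : Fin n → Feature d) (z : Feature d) (a : ℝ≥0∞)
    (Φ : Finset (Fin n) → ℝ≥0∞) (S : Finset (Fin n)) (τ : ℝ) :
    leafMean x z (fun A => a * Φ A) S τ = a * leafMean x z Φ S τ :=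
  lintegral_const_mul _ (measurable_leafAt_fun x z Φ S τ)

/-- The leaf of a new point `x j` compared to the leaf of `x j` in the tree grown with `x j`. -/
lemma leafMean_le_insert (x : Fin n → Feature d) {j : Fin n} {Φ : Finset (Fin n) → ℝ≥0∞}
    (hΦ : ∀ A, Φ A ≤ 1) {S : Finset (Fin n)} (hj : j ∉ S) {τ : ℝ} (hτ : 0 < τ) :
    leafMean x (x j) Φ S τ ≤
      leafMean x (x j) (fun A => if A = {j} then 1 else Φ (A.erase j)) (insert j S) τ := by
  -- The complement `1 - Φ` reverses the comparison, both leaf laws having mass 1; the value on an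
  -- isolated leaf changes from 0 to 1.
  have h := leafMean_insert_le x (fun A => 1 - Φ A) hj hτ
  have h1 : leafMean x (x j) Φ S τ + leafMean x (x j) (fun A => 1 - Φ A) S τ = 1 := by
    rw [← leafMean_add]
    simp [hΦ, leafMean_const]
  have h2 : leafMean x (x j) (fun A => if A = {j} then 1 else Φ (A.erase j)) (insert j S) τ +
      leafMean x (x j) (fun A => if A = {j} then 0 else 1 - Φ (A.erase j)) (insert j S) τ = 1 := by
    have (A : Finset (Fin n)) : (if A = {j} then 1 else Φ (A.erase j)) +
        (if A = {j} then 0 else 1 - Φ (A.erase j)) = 1 := by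
      split_ifs <;> simp [hΦ]
    rw [← leafMean_add]
    simp only [this, leafMean_const]
  have hfin : leafMean x (x j) (fun A => 1 - Φ A) S τ ≠ ∞ := by
    refine ne_top_of_le_ne_top ENNReal.one_ne_top ?_
    calc _ ≤ _ := le_add_self
      _ = 1 := h1
  refine (ENNReal.add_le_add_iff_right hfin).1 ?_
  rw [h1]
  refine h2.symm.le.trans ?_
  gcongr

end Compare

/-! ### Total mass over the leaves, small leaves and separated points -/

section Sums

variable {d n : ℕ} (x : Fin n → Feature d)

lemma sum_side (q : Plane d) (P S : Finset (Fin n)) (g : Fin n → Finset (Fin n) → ℝ≥0∞) :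
    ∑ j ∈ S ∩ P, g j (side x q (x j) S) =
      ∑ j ∈ (S.filter fun i => q.IsLeft (x i)) ∩ P, g j (S.filter fun i => q.IsLeft (x i)) +
      ∑ j ∈ (S.filter fun i => ¬ q.IsLeft (x i)) ∩ P, g j (S.filter fun i => ¬ q.IsLeft (x i)) := by
  rw [← Finset.sum_filter_add_sum_filter_not (S ∩ P) fun i => q.IsLeft (x i)]
  congr 1
  · refine Finset.sum_congr (by ext i; simp; tauto) fun j hj => ?_
    simp only [Finset.mem_inter, Finset.mem_filter] at hj
    congr 1
    simp [side, hj.1.2]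
  · refine Finset.sum_congr (by ext i; simp; tauto) fun j hj => ?_
    simp only [Finset.mem_inter, Finset.mem_filter] at hj
    congr 1
    simp [side, hj.1.2]

lemma card_left_lt {q : Plane d} {S : Finset (Fin n)} (hq : q ∈ splits x S) :
    (S.filter fun i => q.IsLeft (x i)).card < S.card := by
  obtain ⟨j, hj, hj'⟩ := hq.2
  exact Finset.card_lt_card (Finset.filter_ssubset.2 ⟨j, hj, hj'⟩)

lemma card_right_lt {q : Plane d} {S : Finset (Fin n)} (hq : q ∈ splits x S) :
    (S.filter fun i => ¬ q.IsLeft (x i)).card < S.card := by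
  obtain ⟨j, hj, hj'⟩ := hq.1
  exact Finset.card_lt_card (Finset.filter_ssubset.2 ⟨j, hj, not_not.2 hj'⟩)

variable [NeZero d]

lemma sum_leafMean_le (Φ : Finset (Fin n) → ℝ≥0∞) (P S : Finset (Fin n)) {τ : ℝ} (hτ : 0 < τ) :
    ∑ j ∈ S ∩ P, leafMean x (x j) Φ S τ ≤
      ENNReal.ofReal (Real.exp (-(rate (hull x S) * τ))) * ∑ _j ∈ S ∩ P, Φ S +
      ∫⁻ c in Set.Ioo 0 τ, ∫⁻ q in splits x S,
        ENNReal.ofReal (Real.exp (-(rate (hull x S) * c))) *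
          ∑ j ∈ S ∩ P, leafMean x (x j) Φ (side x q (x j) S) (τ - c) ∂planeMeasure d := by
  simp_rw [fun j => leafMean_eq x (x j) Φ S hτ]
  rw [Finset.sum_add_distrib, Finset.mul_sum]
  gcongr
  refine (sum_lintegral_le _ _ _).trans (lintegral_mono fun c => ?_)
  refine (sum_lintegral_le _ _ _).trans (lintegral_mono fun q => ?_)
  simp only [Finset.mul_sum]
  exact le_rfl

/-- Averaging over the leaves does not increase the total mass. -/
lemma sum_leafMean_average_le (f : Fin n → ℝ≥0∞) (S : Finset (Fin n)) {τ : ℝ} (hτ : 0 < τ) :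
    ∑ j ∈ S, leafMean x (x j) (fun A => (∑ i ∈ A, f i) / A.card) S τ ≤ ∑ i ∈ S, f i := by
  induction hk : S.card using Nat.strong_induction_on generalizing S τ with
  | _ k ih =>
    have h := sum_leafMean_le x (fun A => (∑ i ∈ A, f i) / A.card) Finset.univ S hτ
    simp only [Finset.inter_univ] at h
    -- A cut distributes the total mass over the two children without changing it, hence growth rate
    -- 0.
    refine h.trans ((growth_bound (κ := 0) (B := ∑ i ∈ S, f i) ?_ hτ ?_ ?_).trans ?_)
    · simpa using rate_hull_nonneg x S
    · rw [Finset.sum_const, nsmul_eq_mul]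
      exact ENNReal.mul_div_le
    · intro c hc
      have : ∀ q ∈ splits x S, ∑ j ∈ S, leafMean x (x j) (fun A => (∑ i ∈ A, f i) / A.card)
          (side x q (x j) S) (τ - c) ≤ ∑ i ∈ S, f i := by
        intro q hq
        have hs := sum_side x q Finset.univ S
          fun j T => leafMean x (x j) (fun A => (∑ i ∈ A, f i) / A.card) T (τ - c)
        simp only [Finset.inter_univ] at hs
        rw [hs, ← Finset.sum_filter_add_sum_filter_not S fun i => q.IsLeft (x i)]
        exact add_le_add (ih _ (hk ▸ card_left_lt x hq) _ (sub_pos.2 hc.2) rfl)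
          (ih _ (hk ▸ card_right_lt x hq) _ (sub_pos.2 hc.2) rfl)
      refine (setLIntegral_mono' (measurableSet_splits x S) this).trans ?_
      rw [setLIntegral_const, planeMeasure_splits]
      simp [mul_comm]
    · simp

/-- The number of points of `P` that fall in leaves with at most `m` points. -/
lemma sum_leafMean_small_le (m : ℕ) (P S : Finset (Fin n)) {τ : ℝ} (hτ : 0 < τ) :
    ∑ j ∈ S ∩ P, leafMean x (x j) (fun A => if A.card ≤ m then 1 else 0) S τ ≤
      ENNReal.ofReal (Real.exp (rate (hull x P) * τ)) * m := by
  induction hk : S.card using Nat.strong_induction_on generalizing S τ with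
  | _ k ih =>
    have h0 := add_nonneg (rate_hull_nonneg x S) (rate_hull_nonneg x P)
    refine (sum_leafMean_le x _ P S hτ).trans (growth_bound h0 hτ ?_ ?_)
    · rw [Finset.sum_const, nsmul_eq_mul]
      split_ifs with h
      · rw [mul_one]
        exact_mod_cast (Finset.card_le_card Finset.inter_subset_left).trans h
      · simp
    · intro c hc
      set B : ℝ≥0∞ := ENNReal.ofReal (Real.exp (rate (hull x P) * (τ - c))) * m with hB
      -- A hyperplane missing `P` sends all of `S ∩ P` to one child and keeps the bound `B`. One
      -- that splits `P` at most doubles it, and such hyperplanes have mass `rate (hull x P)`: this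
      -- is the growth rate κ.
      have : ∀ q ∈ splits x S, ∑ j ∈ S ∩ P,
          leafMean x (x j) (fun A => if A.card ≤ m then 1 else 0) (side x q (x j) S) (τ - c) ≤
          B + (splits x P).indicator (fun _ => B) q := by
        intro q hq
        rw [sum_side x q P S
          fun j T => leafMean x (x j) (fun A => if A.card ≤ m then 1 else 0) T (τ - c)]
        have hl := ih _ (hk ▸ card_left_lt x hq) (S.filter fun i => q.IsLeft (x i))
          (sub_pos.2 hc.2) rfl
        have hr := ih _ (hk ▸ card_right_lt x hq) (S.filter fun i => ¬ q.IsLeft (x i))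
          (sub_pos.2 hc.2) rfl
        by_cases hP : q ∈ splits x P
        · rw [Set.indicator_of_mem hP]
          exact add_le_add hl hr
        · rw [Set.indicator_of_notMem hP, add_zero]
          by_cases hL : ∃ i ∈ P, q.IsLeft (x i)
          · have : (S.filter fun i => ¬ q.IsLeft (x i)) ∩ P = ∅ := by
              ext i
              simp only [Finset.mem_inter, Finset.mem_filter, Finset.notMem_empty, iff_false]
              exact fun h => hP ⟨hL, i, h.2, h.1.2⟩
            rw [this, Finset.sum_empty, add_zero]
            exact hl
          · have : (S.filter fun i => q.IsLeft (x i)) ∩ P = ∅ := by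
              ext i
              simp only [Finset.mem_inter, Finset.mem_filter, Finset.notMem_empty, iff_false]
              exact fun h => hL ⟨i, h.2, h.1.2⟩
            rw [this, Finset.sum_empty, zero_add]
            exact hr
      refine (setLIntegral_mono' (measurableSet_splits x S) this).trans ?_
      rw [lintegral_add_left measurable_const, setLIntegral_const, planeMeasure_splits,
        mul_assoc (ENNReal.ofReal (_ + _)), ← hB,
        ENNReal.ofReal_add (rate_hull_nonneg x S) (rate_hull_nonneg x P), add_mul, mul_comm B]
      gcongr
      refine (setLIntegral_le_lintegral _ _).trans ?_
      rw [lintegral_indicator_const (measurableSet_splits x P), planeMeasure_splits, mul_comm]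

/-- If the hyperplanes in `H` separate `x j` from all the points of `F`, then the leaf of `x j` is
unlikely to contain one of them. -/
lemma leafMean_meets_le {H : Set (Plane d)} (hH : MeasurableSet H) {lam : ℝ} (hlam : 0 ≤ lam)
    (hHlam : planeMeasure d H = ENNReal.ofReal lam) (F : Finset (Fin n)) {j : Fin n}
    (hF : ∀ q ∈ H, ∀ i ∈ F, ¬ (q.IsLeft (x i) ↔ q.IsLeft (x j))) {S : Finset (Fin n)}
    (hj : j ∈ S) {τ : ℝ} (hτ : 0 < τ) :
    leafMean x (x j) (fun A => if (A ∩ F).Nonempty then 1 else 0) S τ ≤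
      ENNReal.ofReal (Real.exp (-lam * τ)) := by
  induction hk : S.card using Nat.strong_induction_on generalizing S τ with
  | _ k ih =>
    by_cases hSF : (S ∩ F).Nonempty
    swap
    · refine (leafMean_mono (Ψ := fun _ => 0) x _ fun A hA => ?_).trans ?_
      · rw [if_neg fun h => hSF (h.mono (Finset.inter_subset_inter_right hA))]
      · simp [leafMean_const]
    obtain ⟨i, hi⟩ := hSF
    rw [Finset.mem_inter] at hi
    -- As long as the node holds both `x j` and a point of `F`, each hyperplane of `H` splits it.
    have hsub : H ⊆ splits x S := by
      intro q hq
      have := hF q hq i hi.2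
      by_cases hl : q.IsLeft (x j)
      · exact ⟨⟨j, hj, hl⟩, i, hi.1, fun h => this ⟨fun _ => hl, fun _ => h⟩⟩
      · refine ⟨⟨i, hi.1, ?_⟩, j, hj, hl⟩
        by_contra h
        exact this ⟨fun h' => absurd h' h, fun h' => absurd h' hl⟩
    have hle : lam ≤ rate (hull x S) := by
      rw [← ENNReal.ofReal_le_ofReal_iff (rate_hull_nonneg x S), ← hHlam, ← planeMeasure_splits]
      exact measure_mono hsub
    rw [leafMean_eq _ _ _ _ hτ, ← mul_one (ENNReal.ofReal (Real.exp (-lam * τ)))]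
    -- Here κ = -λ: a cut from `H` removes all points of `F` from the node of `x j` for good, so
    -- only the remaining mass R - λ contributes.
    refine growth_bound (by linarith) hτ (by split_ifs <;> simp) fun c hc => ?_
    have : ∀ q ∈ splits x S,
        leafMean x (x j) (fun A => if (A ∩ F).Nonempty then 1 else 0) (side x q (x j) S) (τ - c) ≤
        (splits x S \ H).indicator
          (fun _ => ENNReal.ofReal (Real.exp (-lam * (τ - c)))) q := by
      intro q hq
      by_cases hqH : q ∈ H
      · refine (leafMean_mono (Ψ := fun _ => 0) x _ fun A hA => ?_).trans ?_
        · rw [if_neg]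
          rintro ⟨i, hi⟩
          rw [Finset.mem_inter] at hi
          exact hF q hqH i hi.2 (Finset.mem_filter.1 (hA hi.1)).2
        · simp [leafMean_const]
      · rw [Set.indicator_of_mem (show q ∈ splits x S \ H from ⟨hq, hqH⟩)]
        exact ih _ (hk ▸ card_side_lt _ hq) (Finset.mem_filter.2 ⟨hj, Iff.rfl⟩)
          (sub_pos.2 hc.2) rfl
    refine (setLIntegral_mono' (measurableSet_splits x S) this).trans ?_
    refine (setLIntegral_le_lintegral _ _).trans ?_
    rw [lintegral_indicator_const ((measurableSet_splits x S).diff hH), mul_one, mul_comm,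
      measure_sdiff hsub hH.nullMeasurableSet (by rw [hHlam]; exact ENNReal.ofReal_ne_top), hHlam,
      planeMeasure_splits, ← ENNReal.ofReal_sub _ hlam, sub_eq_add_neg]

end Sums

end

end BSPForest

/-! ### Locality of leaves, and the number of points in small leaves -/

namespace BSPForest

noncomputable section

open scoped Classical ENNReal

section Far

variable {d n : ℕ}

/-- Hyperplanes normal to the angles in `I` whose position is close to that of `z`. -/
def slab (p : Fin d × Fin d) (I : Set ℝ) (z : Feature d) (b η : ℝ) : Set (Plane d) :=
  {q | q.1 = p ∧ q.2.1 ∈ I ∧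
    q.2.2 ∈ Set.Ico (height q.1 q.2.1 z + b) (height q.1 q.2.1 z + b + η)}

lemma measurableSet_slab (p : Fin d × Fin d) {I : Set ℝ} (hI : MeasurableSet I) (z : Feature d)
    (b η : ℝ) : MeasurableSet (slab p I z b η) := by
  have hh : Measurable fun q : Plane d => height q.1 q.2.1 z := by fun_prop
  refine MeasurableSet.inter ?_ (MeasurableSet.inter ?_ (MeasurableSet.inter ?_ ?_))
  · exact measurable_fst (measurableSet_singleton p)
  · exact hI.preimage (by fun_prop)
  · exact measurableSet_le (f := fun q : Plane d => height q.1 q.2.1 z + b)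
      (g := fun q => q.2.2) (by fun_prop) (by fun_prop)
  · exact measurableSet_lt (f := fun q : Plane d => q.2.2)
      (g := fun q => height q.1 q.2.1 z + b + η) (by fun_prop) (by fun_prop)

lemma planeMeasure_slab {p : Fin d × Fin d} (hp : p ∈ pairs d) {I : Set ℝ}
    (hI : MeasurableSet I) (hI' : I ⊆ Set.Ioc 0 Real.pi) (z : Feature d) (b η : ℝ) :
    planeMeasure d (slab p I z b η) = ENNReal.ofReal η * volume I := by
  rw [planeMeasure_apply (measurableSet_slab p hI z b η), Finset.sum_eq_single_of_mem p hp]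
  · have : ∀ θ, volume {t | (p, θ, t) ∈ slab p I z b η} =
        I.indicator (fun _ => ENNReal.ofReal η) θ := by
      intro θ
      by_cases hθ : θ ∈ I
      · rw [Set.indicator_of_mem hθ]
        have : {t | (p, θ, t) ∈ slab p I z b η} =
            Set.Ico (height p θ z + b) (height p θ z + b + η) := by
          ext t; simp [slab, hθ]
        rw [this, Real.volume_Ico]
        congr 1
        ring
      · rw [Set.indicator_of_notMem hθ]
        simp [slab, hθ]
    simp_rw [this]
    rw [lintegral_indicator hI, setLIntegral_const, Measure.restrict_apply hI,
      Set.inter_eq_left.2 hI']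
  · intro p' _ hne
    simp [slab, hne]

/-- A quarter of the directions, in which all points of two opposite quadrants are separated. -/
def angles (b : Bool) : Set ℝ :=
  if b then Set.Icc (Real.pi / 6) (Real.pi / 3) else Set.Icc (2 * Real.pi / 3) (5 * Real.pi / 6)

lemma measurableSet_angles (b : Bool) : MeasurableSet (angles b) := by
  unfold angles; split_ifs <;> exact measurableSet_Icc

lemma angles_subset (b : Bool) : angles b ⊆ Set.Ioc 0 Real.pi := by
  have := Real.pi_pos
  unfold angles
  split_ifs <;> rintro θ ⟨h1, h2⟩ <;> constructor <;> linarith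

lemma volume_angles (b : Bool) : volume (angles b) = ENNReal.ofReal (Real.pi / 6) := by
  unfold angles
  split_ifs <;> rw [Real.volume_Icc] <;> congr 1 <;> ring

lemma half_le_cos {θ : ℝ} (h : θ ∈ Set.Icc (Real.pi / 6) (Real.pi / 3)) :
    1 / 2 ≤ Real.cos θ ∧ 1 / 2 ≤ Real.sin θ := by
  have := Real.pi_pos
  rw [← Real.cos_pi_div_three]
  refine ⟨Real.cos_le_cos_of_nonneg_of_le_pi ?_ ?_ h.2, ?_⟩
  · linarith [h.1]
  · linarith [h.2]
  · rw [Real.cos_pi_div_three, ← Real.sin_pi_div_six]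
    exact Real.sin_le_sin_of_le_of_le_pi_div_two (by linarith) (by linarith [h.2]) h.1

lemma cos_sin_angles {b : Bool} {θ : ℝ} (h : θ ∈ angles b) :
    (if b then 1 / 2 ≤ Real.cos θ else Real.cos θ ≤ -(1 / 2)) ∧ 1 / 2 ≤ Real.sin θ := by
  cases b with
  | true =>
    exact half_le_cos (by simpa [angles] using h)
  | false =>
    have h' : θ ∈ Set.Icc (2 * Real.pi / 3) (5 * Real.pi / 6) := by simpa [angles] using h
    have := half_le_cos (θ := Real.pi - θ) ⟨by linarith [h'.2], by linarith [h'.1]⟩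
    rw [Real.cos_pi_sub, Real.sin_pi_sub] at this
    simp only [Bool.false_eq_true, if_false]
    exact ⟨by linarith, this.2⟩

/-- The points that lie beyond `z` by at least `η` in all the directions of `angles b`, or behind
`z` in all of them. -/
def Beyond (p : Fin d × Fin d) (b s : Bool) (z : Feature d) (η : ℝ) (y : Feature d) : Prop :=
  ∀ θ ∈ angles b, if s then height p θ z + η ≤ height p θ y else height p θ y ≤ height p θ z - η

lemma exists_pair (hd : 2 ≤ d) (a : Fin d) : ∃ p ∈ pairs d, p.1 = a ∨ p.2 = a := by
  have : NeZero d := ⟨by omega⟩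
  by_cases h : a = 0
  · exact ⟨(0, ⟨1, hd⟩), by simp [pairs, Fin.pos_iff_ne_zero, Fin.ext_iff], Or.inl h.symm⟩
  · exact ⟨(0, a), by simp [pairs, Fin.pos_iff_ne_zero, h], Or.inr rfl⟩

/-- Some coordinate of `y - z` is at least δ/d in size; pair it with any other. The angles `angles
b`, with `b` chosen by the relative signs in this plane, make both terms of the height difference
have the same sign, and |cos|, |sin| ≥ 1/2 there gives the factor 1/2. The sign `s` records the
direction. -/
lemma exists_beyond (hd : 2 ≤ d) {z y : Feature d} {δ : ℝ} (hδ : 0 < δ) (h : δ < dist y z) :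
    ∃ p ∈ pairs d, ∃ b s, Beyond p b s z (δ / d / 2) y := by
  have hd0 : (0 : ℝ) < d := by positivity
  obtain ⟨a, ha⟩ : ∃ a, δ / d ≤ |y a - z a| := by
    by_contra! hcon
    apply absurd h
    rw [not_lt, EuclideanSpace.dist_eq]
    apply Real.sqrt_le_iff.2 ⟨hδ.le, ?_⟩
    calc ∑ i, dist (y i) (z i) ^ 2 ≤ ∑ _i : Fin d, (δ / d) ^ 2 := by
          refine Finset.sum_le_sum fun i _ => ?_
          rw [Real.dist_eq]
          exact pow_le_pow_left₀ (abs_nonneg _) (hcon i).le 2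
      _ = δ ^ 2 / d := by
          rw [Finset.sum_const, Finset.card_univ, Fintype.card_fin, nsmul_eq_mul]
          field_simp
      _ ≤ δ ^ 2 := div_le_self (sq_nonneg _) (by exact_mod_cast (by omega : 1 ≤ d))
  obtain ⟨p, hp, hpa⟩ := exists_pair hd a
  have hsum : δ / d ≤ |y p.1 - z p.1| + |y p.2 - z p.2| := by
    rcases hpa with rfl | rfl
    · exact ha.trans (le_add_of_nonneg_right (abs_nonneg _))
    · exact ha.trans (le_add_of_nonneg_left (abs_nonneg _))
  refine ⟨p, hp, ?_⟩
  simp only [Beyond, height]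
  rcases le_total 0 (y p.1 - z p.1) with h1 | h1 <;> rcases le_total 0 (y p.2 - z p.2) with h2 | h2
  · refine ⟨true, true, fun θ hθ => ?_⟩
    rw [abs_of_nonneg h1, abs_of_nonneg h2] at hsum
    have := cos_sin_angles hθ
    simp only [if_true] at this ⊢
    nlinarith [mul_le_mul_of_nonneg_left this.1 h1, mul_le_mul_of_nonneg_left this.2 h2]
  · refine ⟨false, false, fun θ hθ => ?_⟩
    rw [abs_of_nonneg h1, abs_of_nonpos h2] at hsum
    have := cos_sin_angles hθ
    simp only [Bool.false_eq_true, if_false] at this ⊢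
    nlinarith [mul_le_mul_of_nonneg_left this.1 h1, mul_le_mul_of_nonpos_left this.2 h2]
  · refine ⟨false, true, fun θ hθ => ?_⟩
    rw [abs_of_nonpos h1, abs_of_nonneg h2] at hsum
    have := cos_sin_angles hθ
    simp only [Bool.false_eq_true, if_false, if_true] at this ⊢
    nlinarith [mul_le_mul_of_nonpos_left this.1 h1, mul_le_mul_of_nonneg_left this.2 h2]
  · refine ⟨true, false, fun θ hθ => ?_⟩
    rw [abs_of_nonpos h1, abs_of_nonpos h2] at hsum
    have := cos_sin_angles hθ
    simp only [Bool.false_eq_true, if_false, if_true] at this ⊢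
    nlinarith [mul_le_mul_of_nonpos_left this.1 h1, mul_le_mul_of_nonpos_left this.2 h2]

variable [NeZero d] (x : Fin n → Feature d)

lemma leafMean_sum {ι : Type*} (s : Finset ι) (z : Feature d) (Φ : ι → Finset (Fin n) → ℝ≥0∞)
    (S : Finset (Fin n)) (τ : ℝ) :
    leafMean x z (fun A => ∑ i ∈ s, Φ i A) S τ = ∑ i ∈ s, leafMean x z (Φ i) S τ :=
  lintegral_finsetSum _ fun i _ => measurable_leafAt_fun x z (Φ i) S τ

lemma leafMean_beyond_le {p : Fin d × Fin d} (hp : p ∈ pairs d) (b s : Bool) {η : ℝ} (hη : 0 ≤ η)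
    {S : Finset (Fin n)} {j : Fin n} (hj : j ∈ S) {τ : ℝ} (hτ : 0 < τ) :
    leafMean x (x j) (fun A => if ∃ i ∈ A, Beyond p b s (x j) η (x i) then 1 else 0) S τ ≤
      ENNReal.ofReal (Real.exp (-(η * (Real.pi / 6)) * τ)) := by
  -- The window of positions lies just above the height of `x j` for points beyond it and just below
  -- for points behind it, so every hyperplane of the slab separates them from `x j`. The half-open
  -- ends match the closed left side.
  have hm : planeMeasure d (slab p (angles b) (x j) (if s then 0 else -η) η) =
      ENNReal.ofReal (η * (Real.pi / 6)) := by
    rw [planeMeasure_slab hp (measurableSet_angles b) (angles_subset b), volume_angles,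
      ENNReal.ofReal_mul hη]
  refine le_trans (leafMean_mono x _ fun A _ => ?_) (leafMean_meets_le x
    (measurableSet_slab p (measurableSet_angles b) (x j) _ η) (by positivity) hm
    (Finset.univ.filter fun i => Beyond p b s (x j) η (x i)) ?_ hj hτ)
  · apply le_of_eq
    congr 1
    simp [Finset.Nonempty]
  · rintro q ⟨rfl, hθ, hq1, hq2⟩ i hi
    have hi' := (Finset.mem_filter.1 hi).2 _ hθ
    simp only [Plane.IsLeft]
    cases s with
    | true =>
      simp only [if_true] at hi' hq1 hq2
      intro h
      have := h.2 (by linarith)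
      linarith
    | false =>
      simp only [Bool.false_eq_true, if_false] at hi' hq1 hq2
      intro h
      have := h.1 (by linarith)
      linarith

/-- The leaf of `x j` is unlikely to contain points far from `x j`. -/
lemma leafMean_far_le (hd : 2 ≤ d) {δ : ℝ} (hδ : 0 < δ) {S : Finset (Fin n)} {j : Fin n}
    (hj : j ∈ S) {τ : ℝ} (hτ : 0 < τ) :
    leafMean x (x j) (fun A => if ∃ i ∈ A, δ < dist (x i) (x j) then 1 else 0) S τ ≤
      ((pairs d).card * 4 : ℕ) * ENNReal.ofReal (Real.exp (-(δ / d / 2 * (Real.pi / 6)) * τ)) := by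
  -- Union bound over coordinate pairs and the four quadrants.
  have h : ∀ A ⊆ S, (if ∃ i ∈ A, δ < dist (x i) (x j) then 1 else 0 : ℝ≥0∞) ≤
      ∑ k ∈ pairs d ×ˢ (Finset.univ : Finset (Bool × Bool)),
        if ∃ i ∈ A, Beyond k.1 k.2.1 k.2.2 (x j) (δ / d / 2) (x i) then 1 else 0 := by
    intro A _
    split_ifs with h
    · obtain ⟨i, hi, hdist⟩ := h
      obtain ⟨p, hp, b, s, hb⟩ := exists_beyond hd hδ hdist
      refine le_trans ?_ (Finset.single_le_sum (fun _ _ => zero_le)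
        (Finset.mk_mem_product hp (Finset.mem_univ (b, s))))
      rw [if_pos ⟨i, hi, hb⟩]
    · exact zero_le
  refine (leafMean_mono x _ h).trans ?_
  rw [leafMean_sum]
  refine (Finset.sum_le_card_nsmul _ _ _ fun k hk =>
    leafMean_beyond_le x (Finset.mem_product.1 hk).1 _ _ (by positivity) hj hτ).trans ?_
  rw [Finset.card_product, nsmul_eq_mul]
  simp

end Far

/-! ### Covering a box by cells of side 1/τ -/

section Grid

variable {d n : ℕ} (x : Fin n → Feature d)

lemma rate_hull_le {P : Finset (Fin n)} {δ : ℝ} (hδ : 0 ≤ δ)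
    (h : ∀ i ∈ P, ∀ i' ∈ P, ∀ a, |x i a - x i' a| ≤ δ) :
    rate (hull x P) ≤ (pairs d).card * (Real.pi * (2 * δ)) := by
  have hpi := Real.pi_pos
  rcases P.eq_empty_or_nonempty with rfl | hP
  · rw [rate_hull_empty]; positivity
  rw [rate, ← nsmul_eq_mul]
  refine Finset.sum_le_card_nsmul _ _ _ fun p _ => ?_
  have hc : Continuous fun θ => shadowLength (proj p '' hull x P) θ := by
    simp_rw [shadowLength_hull x hP]
    exact (continuous_hi x hP p).sub (continuous_lo x hP p)
  have hle : ∀ θ ∈ Set.Icc 0 Real.pi, shadowLength (proj p '' hull x P) θ ≤ 2 * δ := by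
    intro θ _
    rw [shadowLength_hull x hP]
    obtain ⟨i, hi1, hi2⟩ := P.exists_mem_eq_inf' hP fun i => height p θ (x i)
    obtain ⟨j, hj1, hj2⟩ := P.exists_mem_eq_sup' hP fun i => height p θ (x i)
    rw [lo, hi, hi2, hj2, height, height]
    have e1 : (x j p.1 - x i p.1) * Real.cos θ ≤ δ * 1 :=
      (le_abs_self _).trans (by
        rw [abs_mul]
        exact mul_le_mul (h j hj1 i hi1 _) (Real.abs_cos_le_one θ) (abs_nonneg _) hδ)
    have e2 : (x j p.2 - x i p.2) * Real.sin θ ≤ δ * 1 :=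
      (le_abs_self _).trans (by
        rw [abs_mul]
        exact mul_le_mul (h j hj1 i hi1 _) (Real.abs_sin_le_one θ) (abs_nonneg _) hδ)
    linarith
  calc perimeter (proj p '' hull x P) ≤ ∫ _θ in (0:ℝ)..Real.pi, 2 * δ :=
        intervalIntegral.integral_mono_on hpi.le (hc.intervalIntegrable _ _)
          (continuous_const.intervalIntegrable _ _) hle
    _ = Real.pi * (2 * δ) := by rw [intervalIntegral.integral_const, smul_eq_mul, sub_zero]

variable [NeZero d]

/-- The number of points in small leaves is bounded, up to the points outside of a box, by the
number of cells of a grid. -/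
lemma sum_leafMean_small_box_le (m B : ℕ) {τ : ℝ} (hτ : 0 < τ) :
    ∑ j, leafMean x (x j) (fun A => if A.card ≤ m then 1 else 0) Finset.univ τ ≤
      ∑ j, (if ∃ a, (B : ℝ) < |x j a| then 1 else 0) +
      ((2 * ⌈B * τ⌉₊ + 1) ^ d * m : ℕ) *
        ENNReal.ofReal (Real.exp ((pairs d).card * (2 * Real.pi))) := by
  set N := ⌈B * τ⌉₊ with hN
  -- The cell of a point in the grid of mesh 1/τ; inside the box its indices range from -N to N.
  set g : Fin n → Fin d → ℤ := fun j a => ⌊τ * x j a⌋ with hg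
  set G : Finset (Fin d → ℤ) := Fintype.piFinset fun _ => Finset.Icc (-(N : ℤ)) N with hG
  set Φ : Finset (Fin n) → ℝ≥0∞ := fun A => if A.card ≤ m then 1 else 0 with hΦ
  have hcard : G.card = (2 * N + 1) ^ d := by
    rw [hG, Fintype.card_piFinset]
    simp only [Int.card_Icc, Finset.prod_const, Finset.card_univ, Fintype.card_fin]
    congr 1
    omega
  have hmem : ∀ j, (¬ ∃ a, (B : ℝ) < |x j a|) → g j ∈ G := by
    intro j hj
    push Not at hj
    rw [hG, Fintype.mem_piFinset]
    intro a
    have h1 := abs_le.1 (hj a)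
    have h2 : (B : ℝ) * τ ≤ N := Nat.le_ceil _
    rw [Finset.mem_Icc]
    constructor
    · rw [Int.le_floor]
      push_cast
      nlinarith [h1.1]
    · rw [← Int.cast_le (R := ℝ)]
      refine (Int.floor_le _).trans ?_
      push_cast
      nlinarith [h1.2]
  have hstep : ∀ j, leafMean x (x j) Φ Finset.univ τ ≤
      (if ∃ a, (B : ℝ) < |x j a| then 1 else 0) +
        ∑ κ ∈ G, if g j = κ then leafMean x (x j) Φ Finset.univ τ else 0 := by
    intro j
    by_cases hj : ∃ a, (B : ℝ) < |x j a|
    · rw [if_pos hj]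
      refine le_trans ?_ le_self_add
      rw [← leafMean_const x (x j) 1 Finset.univ τ]
      refine leafMean_mono x _ fun A _ => ?_
      simp only [hΦ]
      split_ifs <;> simp
    · rw [if_neg hj, zero_add, Finset.sum_ite_eq, if_pos (hmem j hj)]
  refine (Finset.sum_le_sum fun j _ => hstep j).trans ?_
  rw [Finset.sum_add_distrib]
  gcongr
  rw [Finset.sum_comm]
  have hcell : ∀ κ ∈ G, ∑ j, (if g j = κ then leafMean x (x j) Φ Finset.univ τ else 0) ≤
      ENNReal.ofReal (Real.exp ((pairs d).card * (2 * Real.pi))) * m := by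
    intro κ _
    have h := sum_leafMean_small_le x m (Finset.univ.filter fun j => g j = κ) Finset.univ hτ
    rw [Finset.univ_inter, Finset.sum_filter] at h
    refine h.trans ?_
    -- The mesh 1/τ makes rate times τ bounded, so the growth factor per cell does not depend on τ.
    have hr := rate_hull_le x (P := Finset.univ.filter fun j => g j = κ) (δ := 1 / τ)
      (by positivity) ?_
    · have hrate : rate (hull x (Finset.univ.filter fun j => g j = κ)) * τ ≤
          (pairs d).card * (2 * Real.pi) := by
        calc _ ≤ (pairs d).card * (Real.pi * (2 * (1 / τ))) * τ := by gcongr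
          _ = _ := by field_simp
      gcongr
    · intro i hi i' hi' a
      have e : ⌊τ * x i a⌋ = ⌊τ * x i' a⌋ := by
        have := (Finset.mem_filter.1 hi).2.trans (Finset.mem_filter.1 hi').2.symm
        exact congrFun this a
      have := Int.abs_sub_lt_one_of_floor_eq_floor e
      rw [← mul_sub, abs_mul, abs_of_pos hτ] at this
      rw [le_div_iff₀ hτ, mul_comm]
      exact this.le
  refine (Finset.sum_le_card_nsmul _ _ _ hcell).trans ?_
  rw [hcard, nsmul_eq_mul, Nat.cast_mul, mul_comm (ENNReal.ofReal _), mul_assoc]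

end Grid

end

end BSPForest

/-! ### Conditionally independent labels and exchangeable features -/

namespace BSPForest

noncomputable section

open scoped Classical ENNReal

section PiKernel

variable {α K : Type*} [MeasurableSpace α] [MeasurableSpace K]

lemma lintegral_pi_prod {n : ℕ} (ν : Measure α) [IsProbabilityMeasure ν] {f : Fin n → α → ℝ≥0∞}
    (hf : ∀ i, Measurable (f i)) :
    ∫⁻ x, ∏ i, f i (x i) ∂Measure.pi (fun _ => ν) = ∏ i, ∫⁻ z, f i z ∂ν := by
  refine (lintegral_prod_eq_prod_lintegral_of_indepFun Finset.univ
    (fun i (x : Fin n → α) => f i (x i)) (iIndepFun_pi fun i => (hf i).aemeasurable)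
    fun i => (hf i).comp (measurable_pi_apply i)).trans ?_
  exact Finset.prod_congr rfl fun i _ =>
    (measurePreserving_eval (fun _ : Fin n => ν) i).lintegral_comp (hf i)

lemma measurable_pi_kernel (n : ℕ) (κ : Kernel α K) [IsMarkovKernel κ] :
    Measurable fun x : Fin n → α => Measure.pi fun i => κ (x i) := by
  refine Measurable.measure_of_isPiSystem_of_isProbabilityMeasure generateFrom_pi.symm
    isPiSystem_pi ?_
  rintro _ ⟨s, hs, rfl⟩
  simp only [Measure.pi_pi]
  refine Finset.measurable_prod _ fun i _ => ?_
  have hi : MeasurableSet (s i) := hs i (Set.mem_univ _)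
  exact (κ.measurable_coe hi).comp (measurable_pi_apply i)

/-- The independent product of `n` copies of a Markov kernel. -/
def piKernel (n : ℕ) (κ : Kernel α K) [IsMarkovKernel κ] : Kernel (Fin n → α) (Fin n → K) :=
  ⟨fun x => Measure.pi fun i => κ (x i), measurable_pi_kernel n κ⟩

instance (n : ℕ) (κ : Kernel α K) [IsMarkovKernel κ] : IsMarkovKernel (piKernel n κ) :=
  ⟨fun x => inferInstanceAs (IsProbabilityMeasure (Measure.pi fun i => κ (x i)))⟩

/-- An i.i.d. sample of pairs consists of i.i.d. first components and second components that are
independent given the first ones. -/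
lemma lintegral_pi_compProd {n : ℕ} (ν : Measure α) [IsProbabilityMeasure ν] (κ : Kernel α K)
    [IsMarkovKernel κ] {F : (Fin n → α × K) → ℝ≥0∞} (hF : Measurable F) :
    ∫⁻ data, F data ∂Measure.pi (fun _ => ν ⊗ₘ κ) =
      ∫⁻ x, ∫⁻ y, F (fun i => (x i, y i)) ∂piKernel n κ x ∂Measure.pi fun _ => ν := by
  have hzip : Measurable fun p : (Fin n → α) × (Fin n → K) => fun i => (p.1 i, p.2 i) := by
    fun_prop
  have h : Measure.pi (fun _ : Fin n => ν ⊗ₘ κ) =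
      ((Measure.pi fun _ => ν) ⊗ₘ piKernel n κ).map fun p i => (p.1 i, p.2 i) := by
    refine Measure.pi_eq fun s hs => ?_
    have hms : MeasurableSet (Set.univ.pi s) := MeasurableSet.univ_pi hs
    rw [Measure.map_apply hzip hms, Measure.compProd_apply (hzip hms)]
    have : ∀ x : Fin n → α, piKernel n κ x (Prod.mk x ⁻¹'
        ((fun p : (Fin n → α) × (Fin n → K) => fun i => (p.1 i, p.2 i)) ⁻¹' Set.univ.pi s)) =
        ∏ i, κ (x i) (Prod.mk (x i) ⁻¹' s i) := by
      intro x
      rw [← Measure.pi_pi]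
      rfl
    simp_rw [this]
    rw [lintegral_pi_prod ν (f := fun i z => κ z (Prod.mk z ⁻¹' s i)) fun i =>
      Kernel.measurable_kernel_prodMk_left (hs i)]
    exact Finset.prod_congr rfl fun i _ => (Measure.compProd_apply (hs i)).symm
  rw [h, lintegral_map hF hzip]
  exact Measure.lintegral_compProd (hF.comp hzip)

end PiKernel

section Noise

variable {K : Type*} [MeasurableSpace K] [MeasurableSingletonClass K]

/-- The frequency of a label among independent labels is close to its mean. -/
lemma lintegral_frequency_sub_le {n : ℕ} (p : Fin n → Measure K) [∀ i, IsProbabilityMeasure (p i)]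
    (k : K) {A : Finset (Fin n)} (hA : A.Nonempty) :
    ∫⁻ y, ENNReal.ofReal |((A.filter fun i => y i = k).card : ℝ) / A.card -
      (∑ i ∈ A, (p i).real {k}) / A.card| ∂Measure.pi p ≤ ENNReal.ofReal (1 / √A.card) := by
  set N : ℝ := (A.card : ℝ) with hN
  have hN0 : 0 < N := Nat.cast_pos.2 hA.card_pos
  let X : Fin n → K → ℝ := fun i => if i ∈ A then Set.indicator {k} 1 else 0
  have hXm (i) : Measurable (X i) := by
    simp only [X]
    split_ifs
    · exact measurable_one.indicator (measurableSet_singleton k)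
    · exact measurable_zero
  have hX01 (i y) : X i y ∈ Set.Icc (0:ℝ) 1 := by
    simp only [X]
    split_ifs
    · by_cases h : y ∈ ({k} : Set K) <;> simp [h]
    · simp
  have hXL (i) : MemLp (X i) 2 (p i) :=
    MemLp.of_bound (hXm i).aestronglyMeasurable 1 (Eventually.of_forall fun y => by
      rw [Real.norm_of_nonneg (hX01 i y).1]; exact (hX01 i y).2)
  let Z : (Fin n → K) → ℝ := ∑ i, fun y => X i (y i)
  have hZ (y) : Z y = ((A.filter fun i => y i = k).card : ℝ) := by
    simp only [Z, Finset.sum_apply, X, Finset.card_filter]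
    rw [Nat.cast_sum, ← Finset.sum_filter_add_sum_filter_not Finset.univ (· ∈ A)]
    rw [Finset.sum_eq_zero (s := Finset.univ.filter (· ∉ A)), add_zero, Finset.filter_univ_mem]
    · refine Finset.sum_congr rfl fun i hi => ?_
      rw [if_pos hi]
      by_cases h : y i = k <;> simp [h]
    · intro i hi
      rw [if_neg (Finset.mem_filter.1 hi).2]
      rfl
  have hcomp (i) : MemLp (fun y : Fin n → K => X i (y i)) 2 (Measure.pi p) :=
    (hXL i).comp_measurePreserving (measurePreserving_eval p i)
  have hZL : MemLp Z 2 (Measure.pi p) := memLp_finsetSum' _ fun i _ => hcomp i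
  have hmean : ∫ y, Z y ∂Measure.pi p = ∑ i ∈ A, (p i).real {k} := by
    simp only [Z, Finset.sum_apply]
    rw [integral_finsetSum _ fun i _ => (hcomp i).integrable one_le_two]
    have hi (i : Fin n) : ∫ y, X i (y i) ∂Measure.pi p = if i ∈ A then (p i).real {k} else 0 := by
      have h := integral_map (μ := Measure.pi p) (φ := fun y : Fin n → K => y i)
        (measurable_pi_apply i).aemeasurable (f := X i) (hXm i).aestronglyMeasurable
      rw [(measurePreserving_eval p i).map_eq] at h
      rw [← h]
      simp only [X]
      split_ifs
      · exact integral_indicator_one (measurableSet_singleton k)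
      · simp
    simp_rw [hi]
    rw [Finset.sum_ite_mem, Finset.univ_inter]
  have hvar : Var[Z; Measure.pi p] ≤ N := by
    rw [variance_sum_pi hXL]
    calc ∑ i, Var[X i; p i] ≤ ∑ i, if i ∈ A then (1:ℝ) else 0 := by
          refine Finset.sum_le_sum fun i _ => ?_
          split_ifs with h
          · refine (variance_le_sq_of_bounded (Eventually.of_forall (hX01 i))
              (hXm i).aemeasurable).trans (by norm_num)
          · simp [X, h]
      _ = N := by simp [hN]
  set m := ∑ i ∈ A, (p i).real {k} with hm
  have hint : Integrable (fun y => (Z y - m) ^ 2) (Measure.pi p) :=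
    (hZL.sub (memLp_const m)).integrable_sq
  have hs : 0 < √N := Real.sqrt_pos.2 hN0
  have hss : √N * √N = N := Real.mul_self_sqrt hN0.le
  -- The inequality |u| ≤ u²/(2√N) + √N/2, divided by N, reduces the mean deviation to the variance,
  -- which is at most N.
  have hpt (y : Fin n → K) : |((A.filter fun i => y i = k).card : ℝ) / N - m / N| ≤
      (Z y - m) ^ 2 / (2 * N * √N) + 1 / (2 * √N) := by
    rw [← hZ, ← sub_div, abs_div, abs_of_pos hN0, ← sq_abs (Z y - m), ← sub_nonneg]
    have : |Z y - m| ^ 2 / (2 * N * √N) + 1 / (2 * √N) - |Z y - m| / N =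
        (|Z y - m| - √N) ^ 2 / (2 * N * √N) := by
      field_simp
      rw [show N = √N ^ 2 by rw [sq, hss]]
      simp only [Real.sqrt_sq hs.le]
      ring
    rw [this]
    positivity
  calc _ ≤ ∫⁻ y, ENNReal.ofReal ((Z y - m) ^ 2 / (2 * N * √N) + 1 / (2 * √N)) ∂Measure.pi p :=
        lintegral_mono fun y => ENNReal.ofReal_le_ofReal (hpt y)
    _ = ENNReal.ofReal (∫ y, ((Z y - m) ^ 2 / (2 * N * √N) + 1 / (2 * √N)) ∂Measure.pi p) :=
        (ofReal_integral_eq_lintegral_ofReal ((hint.div_const _).add (integrable_const _))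
          (Eventually.of_forall fun y => add_nonneg (div_nonneg (sq_nonneg _) (by positivity))
            (by positivity))).symm
    _ ≤ _ := by
        apply ENNReal.ofReal_le_ofReal
        rw [integral_add (hint.div_const _) (integrable_const _), integral_div, ← hmean,
          ← variance_eq_integral hZL.aemeasurable]
        simp only [integral_const, probReal_univ, smul_eq_mul, one_mul]
        calc _ ≤ N / (2 * N * √N) + 1 / (2 * √N) := by gcongr
          _ = 1 / √N := by field_simp; ring

end Noise

section Exchange

variable {d : ℕ} [NeZero d]

/-- The independent query point becomes the last point of a sample of size n+1, which opens the way
to exchangeability. -/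
lemma lintegral_pi_succ {α : Type*} [MeasurableSpace α] (ν : Measure α) [IsProbabilityMeasure ν]
    (n : ℕ) {F : (Fin n → α) → α → ℝ≥0∞} (hF : Measurable fun a : (Fin n → α) × α => F a.1 a.2) :
    ∫⁻ x, ∫⁻ z, F x z ∂ν ∂Measure.pi (fun _ => ν) =
      ∫⁻ x : Fin (n + 1) → α, F (fun i => x i.castSucc) (x (Fin.last n))
        ∂Measure.pi (fun _ => ν) := by
  have hF' : Measurable fun a : α × (Fin n → α) => F a.2 a.1 :=
    hF.comp (by fun_prop : Measurable fun a : α × (Fin n → α) => (a.2, a.1))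
  rw [← lintegral_prod_symm' (fun a : α × (Fin n → α) => F a.2 a.1) hF']
  have h := measurePreserving_piFinSuccAbove (fun _ : Fin (n + 1) => ν) (Fin.last n)
  rw [← h.lintegral_comp hF']
  refine lintegral_congr fun x => ?_
  congr 1
  funext i
  simp [MeasurableEquiv.piFinSuccAbove, Fin.insertNthEquiv, Fin.init]

/-- The mean over the last point of a sample is the mean over all points. -/
lemma lintegral_leafMean_last_le {n : ℕ} (ν : Measure (Feature d)) [IsProbabilityMeasure ν]
    (Φ : (Fin (n + 1) → Feature d) → Finset (Fin (n + 1)) → ℝ≥0∞)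
    (hΦ : ∀ x (σ : Equiv.Perm (Fin (n + 1))) A, Φ (x ∘ σ) A = Φ x (A.map σ.toEmbedding))
    {τ : ℝ} (hτ : 0 < τ) :
    (n + 1 : ℝ≥0∞) * ∫⁻ x, leafMean x (x (Fin.last n)) (Φ x) Finset.univ τ
        ∂Measure.pi (fun _ => ν) ≤
      ∫⁻ x, ∑ j, leafMean x (x j) (Φ x) Finset.univ τ ∂Measure.pi (fun _ => ν) := by
  have h (j : Fin (n + 1)) : ∫⁻ x, leafMean x (x j) (Φ x) Finset.univ τ ∂Measure.pi (fun _ => ν) =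
      ∫⁻ x, leafMean x (x (Fin.last n)) (Φ x) Finset.univ τ ∂Measure.pi (fun _ => ν) := by
    -- Swapping `j` with the last index preserves the product law, and `hΦ` together with
    -- `leafMean_map` carries one leaf to the other.
    let σ : Equiv.Perm (Fin (n + 1)) := Equiv.swap j (Fin.last n)
    let e := MeasurableEquiv.piCongrLeft (fun _ : Fin (n + 1) => Feature d) σ
    have he : MeasurePreserving e (Measure.pi fun _ => ν) (Measure.pi fun _ => ν) :=
      measurePreserving_piCongrLeft (fun _ => ν) σ
    have hex (x : Fin (n + 1) → Feature d) : e x = x ∘ σ := by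
      funext i
      have := MeasurableEquiv.piCongrLeft_apply_apply σ (β := fun _ => Feature d) x (σ i)
      simpa [σ, e] using this
    rw [← he.lintegral_comp_emb e.measurableEmbedding]
    refine lintegral_congr fun x => ?_
    have hm := leafMean_map x σ.toEmbedding (x (σ j)) (Φ x) Finset.univ hτ
    rw [Finset.map_univ_equiv] at hm
    rw [hex]
    rw [show Φ (x ∘ σ) = fun A => Φ x (A.map σ.toEmbedding) from funext (hΦ x σ)]
    change leafMean (x ∘ σ) (x (σ j)) _ _ _ = _
    rw [show σ j = Fin.last n from Equiv.swap_apply_left _ _] at hm ⊢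
    exact hm.symm
  calc _ = ∑ j, ∫⁻ x, leafMean x (x j) (Φ x) Finset.univ τ ∂Measure.pi (fun _ => ν) := by
        simp_rw [h]
        simp
    _ ≤ _ := sum_lintegral_le _ _ _

end Exchange

end

end BSPForest

/-! ### The bias of leaf averages -/

namespace BSPForest

noncomputable section

open scoped Classical ENNReal

/-- The deviation of the average of `p` over a leaf from its value at `z`, with the value `1` for
small leaves. -/
def deviation {d n : ℕ} (m : ℕ) (p : Feature d → ℝ) (x : Fin n → Feature d) (z : Feature d)
    (A : Finset (Fin n)) : ℝ≥0∞ :=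
  if A.card ≤ m then 1 else ENNReal.ofReal |(∑ i ∈ A, p (x i)) / A.card - p z|

section Deviation

variable {d n : ℕ} {m : ℕ} {p : Feature d → ℝ}

lemma average_mem (hp : ∀ z, p z ∈ Set.Icc (0:ℝ) 1) (x : Fin n → Feature d)
    (A : Finset (Fin n)) : (∑ i ∈ A, p (x i)) / A.card ∈ Set.Icc (0:ℝ) 1 := by
  constructor
  · exact div_nonneg (Finset.sum_nonneg fun i _ => (hp _).1) (Nat.cast_nonneg _)
  · refine div_le_one_of_le₀ ?_ (Nat.cast_nonneg _)
    simpa using Finset.sum_le_card_nsmul A (fun i => p (x i)) 1 fun i _ => (hp _).2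

lemma deviation_le_one (hp : ∀ z, p z ∈ Set.Icc (0:ℝ) 1) (x : Fin n → Feature d) (z : Feature d)
    (A : Finset (Fin n)) : deviation m p x z A ≤ 1 := by
  unfold deviation
  split_ifs
  · exact le_rfl
  · rw [ENNReal.ofReal_le_one, abs_le]
    have h1 := average_mem hp x A
    have h2 := hp z
    constructor <;> linarith [h1.1, h1.2, h2.1, h2.2]

lemma measurable_deviation (hp : Measurable p) (A : Finset (Fin n)) :
    Measurable fun a : (Fin n → Feature d) × Feature d => deviation m p a.1 a.2 A := by
  unfold deviation
  split_ifs
  · exact measurable_const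
  · apply Measurable.ennreal_ofReal
    have h1 : Measurable fun a : (Fin n → Feature d) × Feature d => ∑ i ∈ A, p (a.1 i) :=
      Finset.measurable_sum _ fun i _ => hp.comp (by fun_prop)
    have h2 : Measurable fun a : (Fin n → Feature d) × Feature d => p a.2 := hp.comp measurable_snd
    have h3 : Measurable fun a : (Fin n → Feature d) × Feature d =>
        (∑ i ∈ A, p (a.1 i)) / (A.card : ℝ) - p a.2 := (h1.div_const _).sub h2
    exact continuous_abs.measurable.comp h3

/-- The deviation over a leaf in terms of an approximation of `p` by `g`. -/
lemma deviation_erase_le (hp : ∀ z, p z ∈ Set.Icc (0:ℝ) 1) {g : Feature d → ℝ} {ε δ C : ℝ}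
    (hε : 0 ≤ ε) (hg : ∀ a b, dist a b ≤ δ → |g a - g b| ≤ ε) (hC : ∀ a b, |g a - g b| ≤ C)
    (x : Fin n → Feature d) (j : Fin n) (A : Finset (Fin n)) :
    (if A = {j} then 1 else deviation m p x (x j) (A.erase j)) ≤
      (if A.card ≤ m + 1 then 1 else 0) +
      (2 * ((∑ i ∈ A, ENNReal.ofReal |p (x i) - g (x i)|) / A.card) +
      (ENNReal.ofReal ε + (ENNReal.ofReal C * (if ∃ i ∈ A, δ < dist (x i) (x j) then 1 else 0) +
        ENNReal.ofReal |p (x j) - g (x j)|))) := by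
  have hC0 : 0 ≤ C := (abs_nonneg _).trans (hC 0 0)
  -- Erasing `j` can lose one point, so the threshold rises to m + 1. The isolated leaf {j} falls in
  -- this case too.
  by_cases hA : A.card ≤ m + 1
  · rw [if_pos hA]
    refine le_trans ?_ le_self_add
    split_ifs
    · exact le_rfl
    · exact deviation_le_one hp x _ _
  rw [if_neg hA, zero_add, if_neg (fun h => hA (by simp [h]))]
  set A0 := A.erase j with hA0
  have hc1 : A.card ≤ A0.card + 1 := by
    have := Finset.pred_card_le_card_erase (s := A) (a := j)
    rw [← hA0] at this
    omega
  have hc0 : 0 < A0.card := by omega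
  rw [deviation, if_neg (by omega)]
  set b : ℝ := if ∃ i ∈ A, δ < dist (x i) (x j) then 1 else 0 with hb
  have hb0 : 0 ≤ b := by rw [hb]; split_ifs <;> norm_num
  have hcR : (0:ℝ) < A0.card := by exact_mod_cast hc0
  have hcR' : (0:ℝ) < A.card := by
    exact_mod_cast (by omega : 0 < A.card)
  have hsum : ∑ i ∈ A0, |p (x i) - g (x i)| ≤ ∑ i ∈ A, |p (x i) - g (x i)| :=
    Finset.sum_le_sum_of_subset_of_nonneg (Finset.erase_subset _ _) fun _ _ _ => abs_nonneg _
  have hterm : ∀ i ∈ A0, |p (x i) - p (x j)| ≤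
      |p (x i) - g (x i)| + (ε + C * b + |p (x j) - g (x j)|) := by
    intro i hi
    have hgi : |g (x i) - g (x j)| ≤ ε + C * b := by
      by_cases hfar : δ < dist (x i) (x j)
      · have : b = 1 := if_pos ⟨i, Finset.mem_of_mem_erase hi, hfar⟩
        rw [this]
        linarith [hC (x i) (x j)]
      · have := hg _ _ (not_lt.1 hfar)
        nlinarith
    have e : p (x i) - p (x j) =
        (p (x i) - g (x i)) + ((g (x i) - g (x j)) - (p (x j) - g (x j))) := by ring
    rw [e]
    refine (abs_add_le _ _).trans (add_le_add_right ((abs_sub _ _).trans ?_) _)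
    exact add_le_add_left hgi _
  have hreal : |(∑ i ∈ A0, p (x i)) / A0.card - p (x j)| ≤
      2 * ((∑ i ∈ A, |p (x i) - g (x i)|) / A.card) + (ε + (C * b + |p (x j) - g (x j)|)) := by
    have e : (∑ i ∈ A0, p (x i)) / A0.card - p (x j) =
        (∑ i ∈ A0, (p (x i) - p (x j))) / A0.card := by
      rw [Finset.sum_sub_distrib, Finset.sum_const, nsmul_eq_mul]
      field_simp
    rw [e, abs_div, abs_of_pos hcR, div_le_iff₀ hcR]
    refine (Finset.abs_sum_le_sum_abs _ _).trans ((Finset.sum_le_sum hterm).trans ?_)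
    rw [Finset.sum_add_distrib, Finset.sum_const, nsmul_eq_mul, add_mul,
      mul_comm (A0.card : ℝ), add_assoc ε]
    gcongr
    refine hsum.trans ?_
    rw [mul_div_assoc', div_mul_eq_mul_div, le_div_iff₀ hcR']
    -- Passing from the average over the leaf without `j` to that over the whole leaf costs at most
    -- a factor 2.
    have h2 : (A.card : ℝ) ≤ 2 * A0.card := by exact_mod_cast (by omega : A.card ≤ 2 * A0.card)
    have h3 : 0 ≤ ∑ i ∈ A, |p (x i) - g (x i)| := Finset.sum_nonneg fun _ _ => abs_nonneg _
    nlinarith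
  refine (ENNReal.ofReal_le_ofReal hreal).trans (le_of_eq ?_)
  have hs0 : 0 ≤ ∑ i ∈ A, |p (x i) - g (x i)| := Finset.sum_nonneg fun _ _ => abs_nonneg _
  rw [ENNReal.ofReal_add (by positivity) (by positivity), ENNReal.ofReal_mul zero_le_two,
    ENNReal.ofReal_div_of_pos hcR', ENNReal.ofReal_sum_of_nonneg fun _ _ => abs_nonneg _,
    ENNReal.ofReal_add hε (by positivity), ENNReal.ofReal_add (by positivity) (abs_nonneg _),
    ENNReal.ofReal_mul hC0, ENNReal.ofReal_natCast]
  congr 4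
  · simp
  · rw [hb]; split_ifs <;> simp

end Deviation

section Bias

variable {d : ℕ} (ν : Measure (Feature d)) [IsProbabilityMeasure ν]

lemma lintegral_pi_sum {n : ℕ} {f : Feature d → ℝ≥0∞} (hf : Measurable f) :
    ∫⁻ x : Fin n → Feature d, ∑ j, f (x j) ∂Measure.pi (fun _ => ν) = n * ∫⁻ z, f z ∂ν := by
  rw [lintegral_finsetSum (f := fun j (x : Fin n → Feature d) => f (x j)) _
    fun j _ => hf.comp (measurable_pi_apply j)]
  simp_rw [fun j => (measurePreserving_eval (fun _ : Fin n => ν) j).lintegral_comp hf]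
  simp

variable [NeZero d]

lemma measurable_leafMean_comp {n : ℕ} {α : Type*} [MeasurableSpace α] {S : Finset (Fin n)}
    {Φ : (Fin n → Feature d) → Feature d → Finset (Fin n) → ℝ≥0∞}
    (hΦ : ∀ A, Measurable fun a : (Fin n → Feature d) × Feature d => Φ a.1 a.2 A)
    {f : α → Fin n → Feature d} {h : α → Feature d} (hf : Measurable f) (hh : Measurable h)
    (τ : ℝ) : Measurable fun a => leafMean (f a) (h a) (Φ (f a) (h a)) S τ := by
  have h1 := measurable_leafMean S hΦ
  have h2 : Measurable fun a => (f a, τ, h a) := hf.prodMk (measurable_const.prodMk hh)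
  have h3 := h1.comp h2
  simp only [Function.comp_def] at h3
  exact h3

/-- The probability that a data point is in a small leaf. -/
lemma lintegral_small_le (n m B : ℕ) {τ : ℝ} (hτ : 0 < τ) :
    ∫⁻ x : Fin (n + 1) → Feature d, leafMean x (x (Fin.last n))
        (fun A => if A.card ≤ m then 1 else 0) Finset.univ τ ∂Measure.pi (fun _ => ν) ≤
      ν {z | ∃ a, (B : ℝ) < |z a|} + ((2 * ⌈B * τ⌉₊ + 1) ^ d * m : ℕ) *
        ENNReal.ofReal (Real.exp ((pairs d).card * (2 * Real.pi))) / (n + 1) := by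
  have hn0 : (n + 1 : ℝ≥0∞) ≠ 0 := by simp
  have hnt : (n + 1 : ℝ≥0∞) ≠ ∞ := by simp
  have hbox : MeasurableSet {z : Feature d | ∃ a, (B : ℝ) < |z a|} := by
    have : {z : Feature d | ∃ a, (B : ℝ) < |z a|} = ⋃ a, {z | (B : ℝ) < |z a|} := by
      ext z; simp
    rw [this]
    refine MeasurableSet.iUnion fun a => measurableSet_lt measurable_const ?_
    exact continuous_abs.measurable.comp (EuclideanSpace.proj (𝕜 := ℝ) a).continuous.measurable
  have h := lintegral_leafMean_last_le ν (n := n) (fun _ A => if A.card ≤ m then 1 else 0)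
    (fun x σ A => by simp) hτ
  have h2 : ∫⁻ x : Fin (n + 1) → Feature d, ∑ j, leafMean x (x j)
      (fun A => if A.card ≤ m then 1 else 0) Finset.univ τ ∂Measure.pi (fun _ => ν) ≤
      (n + 1) * ν {z | ∃ a, (B : ℝ) < |z a|} + ((2 * ⌈B * τ⌉₊ + 1) ^ d * m : ℕ) *
        ENNReal.ofReal (Real.exp ((pairs d).card * (2 * Real.pi))) := by
    refine (lintegral_mono fun x => sum_leafMean_small_box_le x m B hτ).trans ?_
    rw [lintegral_add_right _ measurable_const, lintegral_const, measure_univ, mul_one]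
    gcongr
    have hm : Measurable fun z : Feature d => if ∃ a, (B : ℝ) < |z a| then (1 : ℝ≥0∞) else 0 :=
      Measurable.ite hbox measurable_const measurable_const
    rw [lintegral_pi_sum ν hm, ← lintegral_indicator_one hbox]
    push_cast
    gcongr with z
    simp [Set.indicator]
  have h3 := h.trans h2
  rw [← ENNReal.mul_le_mul_iff_right hn0 hnt, mul_add, ENNReal.mul_div_cancel hn0 hnt]
  exact h3

/-- By exchangeability the query may be averaged over the sample, where leaf averaging does not
increase mass. It bounds the L¹ approximation error after averaging over leaves. -/
lemma lintegral_average_le (n : ℕ) {e : Feature d → ℝ≥0∞} (he : Measurable e) {τ : ℝ}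
    (hτ : 0 < τ) :
    ∫⁻ x : Fin (n + 1) → Feature d, leafMean x (x (Fin.last n))
        (fun A => (∑ i ∈ A, e (x i)) / A.card) Finset.univ τ ∂Measure.pi (fun _ => ν) ≤
      ∫⁻ z, e z ∂ν := by
  have hn0 : (n + 1 : ℝ≥0∞) ≠ 0 := by simp
  have hnt : (n + 1 : ℝ≥0∞) ≠ ∞ := by simp
  have h := lintegral_leafMean_last_le ν (n := n) (fun x A => (∑ i ∈ A, e (x i)) / A.card)
    (fun x σ A => by simp) hτ
  have h2 := h.trans (lintegral_mono fun x =>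
    sum_leafMean_average_le x (fun i => e (x i)) Finset.univ hτ)
  rw [lintegral_pi_sum ν he] at h2
  push_cast at h2
  exact (ENNReal.mul_le_mul_iff_right hn0 hnt).1 h2

/-- The sources of error are: small leaves (outside and inside the box), `p - g` averaged over the
leaf, the variation of `g` at scale δ, leaves reaching farther than δ, and `p - g` at the query
point. -/
lemma lintegral_deviation_le (hd : 2 ≤ d) (n m B : ℕ) {p g : Feature d → ℝ} (hpm : Measurable p)
    (hgm : Measurable g) (hp : ∀ z, p z ∈ Set.Icc (0:ℝ) 1) {ε δ C : ℝ}
    (hε : 0 ≤ ε) (hδ : 0 < δ) (hg : ∀ a b, dist a b ≤ δ → |g a - g b| ≤ ε)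
    (hC : ∀ a b, |g a - g b| ≤ C) {τ : ℝ} (hτ : 0 < τ) :
    ∫⁻ x : Fin n → Feature d, ∫⁻ z, leafMean x z (deviation m p x z) Finset.univ τ ∂ν
      ∂Measure.pi (fun _ => ν) ≤
      (ν {z | ∃ a, (B : ℝ) < |z a|} + ((2 * ⌈B * τ⌉₊ + 1) ^ d * (m + 1) : ℕ) *
        ENNReal.ofReal (Real.exp ((pairs d).card * (2 * Real.pi))) / (n + 1)) +
      (2 * ∫⁻ z, ENNReal.ofReal |p z - g z| ∂ν +
      (ENNReal.ofReal ε + (ENNReal.ofReal C * (((pairs d).card * 4 : ℕ) *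
        ENNReal.ofReal (Real.exp (-(δ / d / 2 * (Real.pi / 6)) * τ))) +
        ∫⁻ z, ENNReal.ofReal |p z - g z| ∂ν))) := by
  have he : Measurable fun z => ENNReal.ofReal |p z - g z| :=
    (continuous_abs.measurable.comp (hpm.sub hgm)).ennreal_ofReal
  have hdev : Measurable fun a : (Fin n → Feature d) × Feature d =>
      leafMean a.1 a.2 (deviation m p a.1 a.2) Finset.univ τ :=
    measurable_leafMean_comp (Φ := deviation m p) (fun A => measurable_deviation hpm A)
      measurable_fst measurable_snd τ
  rw [lintegral_pi_succ ν n hdev]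
  have hpt (x : Fin (n + 1) → Feature d) :
      leafMean (fun i => x i.castSucc) (x (Fin.last n))
        (deviation m p (fun i => x i.castSucc) (x (Fin.last n))) Finset.univ τ ≤
      leafMean x (x (Fin.last n)) (fun A => if A.card ≤ m + 1 then 1 else 0) Finset.univ τ +
      (2 * leafMean x (x (Fin.last n))
        (fun A => (∑ i ∈ A, ENNReal.ofReal |p (x i) - g (x i)|) / A.card) Finset.univ τ +
      (ENNReal.ofReal ε + (ENNReal.ofReal C * (((pairs d).card * 4 : ℕ) *
        ENNReal.ofReal (Real.exp (-(δ / d / 2 * (Real.pi / 6)) * τ))) +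
        ENNReal.ofReal |p (x (Fin.last n)) - g (x (Fin.last n))|))) := by
    have h1 := leafMean_map x (Fin.castSuccEmb (n := n)) (x (Fin.last n))
      (deviation m p x (x (Fin.last n))) Finset.univ hτ
    have h2 : (fun A : Finset (Fin n) => deviation m p x (x (Fin.last n))
        (A.map (Fin.castSuccEmb (n := n)))) =
        deviation m p (fun i => x i.castSucc) (x (Fin.last n)) := by
      funext A
      simp [deviation]
    have h3 : Fin.last n ∉ (Finset.univ : Finset (Fin n)).map Fin.castSuccEmb := by
      simp [Fin.castSucc_ne_last]
    have h4 : insert (Fin.last n) ((Finset.univ : Finset (Fin n)).map Fin.castSuccEmb) =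
        Finset.univ := by
      ext i
      refine Fin.lastCases ?_ (fun i => ?_) i <;> simp
    rw [h2] at h1
    -- The tree of the first n points, queried at the last one, is replaced by the tree grown on all
    -- n + 1 points.
    have h5 := leafMean_le_insert x (fun A => deviation_le_one (m := m) hp x (x (Fin.last n)) A)
      h3 hτ
    rw [h4, h1] at h5
    refine h5.trans ((leafMean_mono x _ fun A _ =>
      deviation_erase_le hp hε hg hC x (Fin.last n) A).trans ?_)
    rw [leafMean_add, leafMean_add, leafMean_add, leafMean_add, leafMean_const_mul,
      leafMean_const_mul, leafMean_const, leafMean_const]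
    gcongr
    exact leafMean_far_le x hd hδ (Finset.mem_univ _) hτ
  refine (lintegral_mono hpt).trans ?_
  have hτm {Φ : (Fin (n + 1) → Feature d) → Finset (Fin (n + 1)) → ℝ≥0∞}
      (hΦ : ∀ A, Measurable fun x => Φ x A) : Measurable fun x : Fin (n + 1) → Feature d =>
      leafMean x (x (Fin.last n)) (Φ x) Finset.univ τ :=
    measurable_leafMean_comp (Φ := fun x _ => Φ x) (fun A => (hΦ A).comp measurable_fst)
      measurable_id (measurable_pi_apply _) τ
  have hm1 := hτm (Φ := fun _ A => if A.card ≤ m + 1 then 1 else 0) fun A => measurable_const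
  have hm2 := hτm (Φ := fun x A => (∑ i ∈ A, ENNReal.ofReal |p (x i) - g (x i)|) / A.card)
    fun A => (Finset.measurable_sum _ fun i _ => he.comp (measurable_pi_apply i)).div_const _
  rw [lintegral_add_left hm1, lintegral_add_left (hm2.const_mul 2), lintegral_const_mul _ hm2,
    lintegral_add_left measurable_const, lintegral_add_left measurable_const,
    (measurePreserving_eval (fun _ : Fin (n + 1) => ν) (Fin.last n)).lintegral_comp he]
  simp only [lintegral_const, measure_univ, mul_one]
  gcongr
  · exact lintegral_small_le ν n (m + 1) B hτ
  · exact lintegral_average_le ν n he hτ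

end Bias

end

end BSPForest

/-! ### The bias tends to zero -/

namespace BSPForest

noncomputable section

open scoped Classical ENNReal

section Limit

variable {d : ℕ} (ν : Measure (Feature d)) [IsProbabilityMeasure ν]

lemma exists_box {η : ℝ≥0∞} (hη : 0 < η) : ∃ B : ℕ, ν {z | ∃ a, (B : ℝ) < |z a|} ≤ η := by
  have hmeas (B : ℕ) : MeasurableSet {z : Feature d | ∃ a, (B : ℝ) < |z a|} := by
    have : {z : Feature d | ∃ a, (B : ℝ) < |z a|} = ⋃ a, {z | (B : ℝ) < |z a|} := by
      ext z; simp
    rw [this]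
    refine MeasurableSet.iUnion fun a => measurableSet_lt measurable_const ?_
    exact continuous_abs.measurable.comp (EuclideanSpace.proj (𝕜 := ℝ) a).continuous.measurable
  have hanti : Antitone fun B : ℕ => {z : Feature d | ∃ a, (B : ℝ) < |z a|} := by
    rintro B B' h z ⟨a, ha⟩
    exact ⟨a, lt_of_le_of_lt (by exact_mod_cast h) ha⟩
  have h := tendsto_measure_iInter_atTop (μ := ν) (fun B => (hmeas B).nullMeasurableSet) hanti
    ⟨0, measure_ne_top _ _⟩
  have hempty : ⋂ B : ℕ, {z : Feature d | ∃ a, (B : ℝ) < |z a|} = ∅ := by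
    ext z
    simp only [Set.mem_iInter, Set.mem_ofPred_eq, Set.mem_empty_iff_false, iff_false, not_forall]
    obtain ⟨B, hB⟩ := exists_nat_ge ‖z‖
    refine ⟨B, ?_⟩
    rintro ⟨a, ha⟩
    have := EuclideanSpace.norm_eq z
    have h2 : |z a| ≤ ‖z‖ := by simpa using PiLp.norm_apply_le z a
    linarith
  rw [hempty, measure_empty] at h
  exact (ENNReal.tendsto_nhds_zero.1 h η hη).exists

lemma tendsto_grid {τ : ℕ → ℝ} (hτ : Tendsto τ atTop atTop)
    (hτn : Tendsto (fun n : ℕ => τ n ^ d / (n : ℝ)) atTop (𝓝 0)) (B m : ℕ) (E : ℝ) :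
    Tendsto (fun n : ℕ => (((2 * ⌈B * τ n⌉₊ + 1) ^ d * m : ℕ) : ℝ≥0∞) * ENNReal.ofReal E / (n + 1))
      atTop (𝓝 0) := by
  have h1 : Tendsto (fun n : ℕ => (2 * B + 3 : ℝ) ^ d * m * (τ n ^ d / (n : ℝ))) atTop (𝓝 0) := by
    simpa using hτn.const_mul ((2 * B + 3 : ℝ) ^ d * m)
  have h2 : Tendsto (fun n : ℕ => (((2 * ⌈B * τ n⌉₊ + 1) ^ d * m : ℕ) : ℝ) / (n + 1))
      atTop (𝓝 0) := by
    refine squeeze_zero' (Eventually.of_forall fun n => by positivity) ?_ h1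
    filter_upwards [hτ.eventually_ge_atTop 1, eventually_gt_atTop 0] with n hn hn0
    have hn0' : (0:ℝ) < n := by exact_mod_cast hn0
    -- The ceiling gives 2Bτ + 3, and τ ≥ 1 absorbs the constant.
    have hc : (2 * ⌈B * τ n⌉₊ + 1 : ℝ) ≤ (2 * B + 3) * τ n := by
      have := (Nat.ceil_lt_add_one (show 0 ≤ (B:ℝ) * τ n by positivity)).le
      linarith
    push_cast
    calc ((2 * ⌈B * τ n⌉₊ + 1 : ℝ)) ^ d * m / (n + 1)
        ≤ ((2 * B + 3) * τ n) ^ d * m / n := by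
          gcongr
          linarith
      _ = _ := by rw [mul_pow]; ring
  have h3 := ENNReal.tendsto_ofReal h2
  rw [ENNReal.ofReal_zero] at h3
  have h4 := ENNReal.Tendsto.mul_const (b := ENNReal.ofReal E) h3 (Or.inr ENNReal.ofReal_ne_top)
  rw [zero_mul] at h4
  refine h4.congr fun n => ?_
  rw [ENNReal.ofReal_div_of_pos (by positivity), ENNReal.ofReal_natCast,
    ENNReal.ofReal_add (by positivity) zero_le_one, ENNReal.ofReal_natCast, ENNReal.ofReal_one,
    ENNReal.mul_div_right_comm]

variable [NeZero d]

/-- The averages of a bounded function over the leaves converge to it in mean. -/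
lemma tendsto_deviation (hd : 2 ≤ d) {p : Feature d → ℝ} (hpm : Measurable p)
    (hp : ∀ z, p z ∈ Set.Icc (0:ℝ) 1) (m : ℕ) {τ : ℕ → ℝ} (hτ : Tendsto τ atTop atTop)
    (hτn : Tendsto (fun n : ℕ => τ n ^ d / (n : ℝ)) atTop (𝓝 0)) :
    Tendsto (fun n : ℕ => ∫⁻ x : Fin n → Feature d, ∫⁻ z,
      leafMean x z (deviation m p x z) Finset.univ (τ n) ∂ν ∂Measure.pi (fun _ => ν))
      atTop (𝓝 0) := by
  rw [ENNReal.tendsto_nhds_zero]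
  intro ε' hε'
  -- Seven shares: box, grid, twice the averaged L¹ error, variation of `g`, far points, L¹ error at
  -- the query.
  obtain ⟨ε, hε, hεε'⟩ : ∃ ε : ℝ, 0 < ε ∧ ENNReal.ofReal (7 * ε) ≤ ε' := by
    obtain ⟨a, ha0, ha⟩ := ENNReal.lt_iff_exists_nnreal_btwn.1 hε'
    refine ⟨a / 7, by have : 0 < a := by exact_mod_cast ha0
                      positivity, ?_⟩
    rw [mul_div_cancel₀ _ (by norm_num), ENNReal.ofReal_coe_nnreal]
    exact ha.le
  have hη : 0 < ENNReal.ofReal ε := ENNReal.ofReal_pos.2 hε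
  have hpi : Integrable p ν := Integrable.of_bound hpm.aestronglyMeasurable 1
    (Eventually.of_forall fun z => by rw [Real.norm_of_nonneg (hp z).1]; exact (hp z).2)
  obtain ⟨g, hgs, hpg, hgc, -⟩ := hpi.exists_hasCompactSupport_lintegral_sub_le hη.ne'
  have hpg' : ∫⁻ z, ENNReal.ofReal |p z - g z| ∂ν ≤ ENNReal.ofReal ε := by
    simpa only [Real.enorm_eq_ofReal_abs] using hpg
  obtain ⟨C, hC⟩ := hgs.exists_bound_of_continuous hgc
  obtain ⟨δ, hδ, hgδ⟩ := Metric.uniformContinuous_iff_le.1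
    (hgs.uniformContinuous_of_continuous hgc) ε hε
  obtain ⟨B, hB⟩ := exists_box ν hη
  have hgrid := ENNReal.tendsto_nhds_zero.1 (tendsto_grid hτ hτn B (m + 1)
    (Real.exp ((pairs d).card * (2 * Real.pi)))) _ hη
  have hfar : Tendsto (fun n => ENNReal.ofReal (2 * C) * (((pairs d).card * 4 : ℕ) *
        ENNReal.ofReal (Real.exp (-(δ / d / 2 * (Real.pi / 6)) * τ n)))) atTop (𝓝 0) := by
    have hd0 : (0:ℝ) < d := by positivity
    have hpi := Real.pi_pos
    have h1 : Tendsto (fun n => Real.exp (-(δ / d / 2 * (Real.pi / 6)) * τ n)) atTop (𝓝 0) :=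
      Real.tendsto_exp_atBot.comp (hτ.const_mul_atTop_of_neg (by
        rw [neg_lt_zero]; positivity))
    have h2 := ENNReal.tendsto_ofReal h1
    rw [ENNReal.ofReal_zero] at h2
    have h3 := ENNReal.Tendsto.const_mul (a := (((pairs d).card * 4 : ℕ) : ℝ≥0∞)) h2
      (Or.inr (ENNReal.natCast_ne_top _))
    rw [mul_zero] at h3
    have h4 := ENNReal.Tendsto.const_mul (a := ENNReal.ofReal (2 * C)) h3
      (Or.inr ENNReal.ofReal_ne_top)
    rwa [mul_zero] at h4
  filter_upwards [hgrid, ENNReal.tendsto_nhds_zero.1 hfar _ hη, hτ.eventually_gt_atTop 0]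
    with n hn1 hn2 hn3
  refine (lintegral_deviation_le ν hd n m B hpm hgc.measurable hp hε.le hδ
    (fun a b hab => by simpa [Real.dist_eq] using hgδ hab) (C := 2 * C) (fun a b => ?_) hn3).trans ?_
  · refine (abs_sub _ _).trans ?_
    have h1 := hC a
    have h2 := hC b
    rw [Real.norm_eq_abs] at h1 h2
    linarith
  refine le_trans ?_ hεε'
  have h7 : ENNReal.ofReal (7 * ε) = (ENNReal.ofReal ε + ENNReal.ofReal ε) +
      (2 * ENNReal.ofReal ε + (ENNReal.ofReal ε + (ENNReal.ofReal ε + ENNReal.ofReal ε))) := by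
    rw [ENNReal.ofReal_mul (by norm_num)]
    norm_num
    ring
  rw [h7]
  gcongr

end Limit

end

end BSPForest

/-! ### Excess risk of plurality votes and consistency of one tree -/

namespace BSPForest

noncomputable section

open scoped Classical ENNReal

section Risk

variable {d : ℕ} {K : Type*} [Fintype K] [MeasurableSpace K]

/-- The conditional probability of the label `k`. -/
def labelProb (κ : Kernel (Feature d) K) (k : K) (z : Feature d) : ℝ := (κ z).real {k}

/-- The conditional probability of a most probable label. -/
def maxProb [Nonempty K] (κ : Kernel (Feature d) K) (z : Feature d) : ℝ :=
  Finset.univ.sup' Finset.univ_nonempty fun k => labelProb κ k z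

/-- The excess of the conditional error probability when predicting `k`. -/
def excess [Nonempty K] (κ : Kernel (Feature d) K) (k : K) (z : Feature d) : ℝ≥0∞ :=
  ENNReal.ofReal (maxProb κ z - labelProb κ k z)

/-- The least conditional error probability. -/
def leastRisk [Nonempty K] (κ : Kernel (Feature d) K) (z : Feature d) : ℝ≥0∞ :=
  ENNReal.ofReal (1 - maxProb κ z)

omit [Fintype K] in
lemma labelProb_mem (κ : Kernel (Feature d) K) [IsMarkovKernel κ] (k : K) (z : Feature d) :
    labelProb κ k z ∈ Set.Icc (0:ℝ) 1 := ⟨measureReal_nonneg, measureReal_le_one⟩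

variable [Nonempty K] (κ : Kernel (Feature d) K)

lemma labelProb_le_maxProb (k : K) (z : Feature d) : labelProb κ k z ≤ maxProb κ z :=
  Finset.le_sup' (fun k => labelProb κ k z) (Finset.mem_univ k)

lemma maxProb_le_one [IsMarkovKernel κ] (z : Feature d) : maxProb κ z ≤ 1 :=
  Finset.sup'_le _ _ fun k _ => (labelProb_mem κ k z).2

lemma excess_le_one [IsMarkovKernel κ] (k : K) (z : Feature d) : excess κ k z ≤ 1 := by
  rw [excess, ENNReal.ofReal_le_one]
  linarith [maxProb_le_one κ z, (labelProb_mem κ k z).1]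

variable [MeasurableSingletonClass K]

omit [Fintype K] [Nonempty K] in
lemma measurable_labelProb (k : K) : Measurable (labelProb κ k) :=
  (κ.measurable_coe (measurableSet_singleton k)).ennreal_toReal

lemma measurable_maxProb : Measurable (maxProb κ) := by
  have h := Finset.measurable_sup' (Finset.univ_nonempty (α := K)) fun k _ =>
    measurable_labelProb κ k
  convert h using 1
  funext z
  rw [maxProb, Finset.sup'_apply]

lemma measurable_excess (k : K) : Measurable (excess κ k) :=
  ((measurable_maxProb κ).sub (measurable_labelProb κ k)).ennreal_ofReal

lemma measurable_leastRisk : Measurable (leastRisk κ) :=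
  ((measurable_maxProb κ).const_sub 1).ennreal_ofReal

variable [IsMarkovKernel κ]

lemma kernel_compl_singleton (k : K) (z : Feature d) :
    κ z {k}ᶜ = leastRisk κ z + excess κ k z := by
  rw [leastRisk, excess, ← ENNReal.ofReal_add (sub_nonneg.2 (maxProb_le_one κ z))
    (sub_nonneg.2 (labelProb_le_maxProb κ k z)), sub_add_sub_cancel, labelProb,
    ← probReal_compl_eq_one_sub (measurableSet_singleton k), ofReal_measureReal]

omit [Nonempty K] in
lemma measurableSet_misclassified {g : Feature d → K} (hg : Measurable g) :
    MeasurableSet {q : Feature d × K | g q.1 ≠ q.2} :=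
  (measurableSet_eq_fun (hg.comp measurable_fst) measurable_snd).compl

/-- The error probability of a classifier. -/
lemma misclassified_eq (ν : Measure (Feature d)) [IsProbabilityMeasure ν] {g : Feature d → K}
    (hg : Measurable g) : (ν ⊗ₘ κ) {q | g q.1 ≠ q.2} =
      ∫⁻ z, leastRisk κ z ∂ν + ∫⁻ z, excess κ (g z) z ∂ν := by
  rw [Measure.compProd_apply (measurableSet_misclassified hg),
    ← lintegral_add_left (measurable_leastRisk κ)]
  refine lintegral_congr fun z => ?_
  rw [← kernel_compl_singleton]
  congr 1
  ext k
  simp [eq_comm]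

end Risk

section Vote

variable {d n : ℕ} {K : Type*}

/-- The majority vote of the labels of the data points in `A`. -/
def leafPredict (sel : (K → ℕ) → K) (y : Fin n → K) (A : Finset (Fin n)) : K :=
  sel fun k => (A.filter fun i => y i = k).card

lemma treePredict_hullCut (sel : (K → ℕ) → K) (y : Fin n → K) (r : ℕ) (x : Fin n → Feature d)
    (ω : Finset (Fin n) → Cut d) (τ : ℝ) (S : Finset (Fin n)) (z : Feature d) :
    treePredict sel y (hullCut r x ω τ S) z = leafPredict sel y (leafAt r x ω τ S z) := rfl

variable [Fintype K] [Nonempty K] [MeasurableSpace K] [MeasurableSingletonClass K]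
  (κ : Kernel (Feature d) K)

omit [MeasurableSingletonClass K] in
-- The elected label has at least the frequency of a most probable one, so its loss is at most the
-- sum of the two frequency errors.
lemma excess_leafPredict_le {sel : (K → ℕ) → K} (hsel : IsPlurality sel) (y : Fin n → K)
    {A : Finset (Fin n)} (hA : A.Nonempty) (z : Feature d) :
    excess κ (leafPredict sel y A) z ≤
      ∑ k, ENNReal.ofReal |((A.filter fun i => y i = k).card : ℝ) / A.card - labelProb κ k z| := by
  rw [excess, ← ENNReal.ofReal_sum_of_nonneg fun _ _ => abs_nonneg _]
  apply ENNReal.ofReal_le_ofReal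
  obtain ⟨k, -, hk⟩ := Finset.exists_mem_eq_sup' (Finset.univ_nonempty (α := K))
    fun k => labelProb κ k z
  rw [maxProb, hk]
  set l := leafPredict sel y A with hl
  have hv : (A.filter fun i => y i = k).card ≤ (A.filter fun i => y i = l).card :=
    hsel (fun k => (A.filter fun i => y i = k).card) k
  have hv' : ((A.filter fun i => y i = k).card : ℝ) / A.card ≤
      ((A.filter fun i => y i = l).card : ℝ) / A.card := by gcongr
  set D : K → ℝ := fun k =>
    |((A.filter fun i => y i = k).card : ℝ) / A.card - labelProb κ k z| with hD
  by_cases hkl : k = l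
  · rw [hkl, sub_self]
    exact Finset.sum_nonneg fun _ _ => abs_nonneg _
  calc labelProb κ k z - labelProb κ l z ≤ D k + D l := by
        have h1 := neg_abs_le
          (((A.filter fun i => y i = k).card : ℝ) / A.card - labelProb κ k z)
        have h2 := le_abs_self
          (((A.filter fun i => y i = l).card : ℝ) / A.card - labelProb κ l z)
        simp only [hD]
        linarith
    _ = ∑ k ∈ {k, l}, D k := (Finset.sum_pair hkl).symm
    _ ≤ ∑ k, D k := Finset.sum_le_sum_of_subset_of_nonneg (Finset.subset_univ _)
        fun _ _ _ => abs_nonneg _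

omit [MeasurableSingletonClass K] in
-- The label elected by the forest has at least one vote, so its loss is that of some tree.
lemma excess_forestPredict_le {sel : (K → ℕ) → K} (hsel : IsPlurality sel) {M : ℕ} (hM : 0 < M)
    (y : Fin n → K) (T : Fin M → Tree d n) (z : Feature d) :
    excess κ (forestPredict sel y T z) z ≤ ∑ m, excess κ (treePredict sel y (T m) z) z := by
  have h := hsel (fun k => (Finset.univ.filter fun m => treePredict sel y (T m) z = k).card)
    (treePredict sel y (T ⟨0, hM⟩) z)
  have h0 : 0 < (Finset.univ.filter fun m =>
      treePredict sel y (T m) z = treePredict sel y (T ⟨0, hM⟩) z).card :=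
    Finset.card_pos.2 ⟨⟨0, hM⟩, by simp⟩
  obtain ⟨m, hm⟩ := Finset.card_pos.1 (h0.trans_le h)
  have hm' : treePredict sel y (T m) z = forestPredict sel y T z := (Finset.mem_filter.1 hm).2
  rw [← hm']
  exact Finset.single_le_sum (f := fun m => excess κ (treePredict sel y (T m) z) z)
    (fun _ _ => zero_le) (Finset.mem_univ m)

/-- The deviation of the label frequency in a large leaf from its mean given the features. -/
def noise (m : ℕ) (k : K) (x : Fin n → Feature d) (y : Fin n → K) (A : Finset (Fin n)) : ℝ≥0∞ :=
  if A.card ≤ m then 0 else ENNReal.ofReal |((A.filter fun i => y i = k).card : ℝ) / A.card -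
    (∑ i ∈ A, labelProb κ k (x i)) / A.card|

omit [MeasurableSingletonClass K] in
-- If the leaf grown without size restriction has more than m ≥ r points, the restricted tree has
-- the same leaf, and the error splits into bias and noise. Otherwise `deviation` is 1, which
-- dominates any excess.
lemma excess_leafAt_le [IsMarkovKernel κ] {sel : (K → ℕ) → K} (hsel : IsPlurality sel) {r m : ℕ}
    (hrm : r ≤ m) (x : Fin n → Feature d) (y : Fin n → K) (ω : Finset (Fin n) → Cut d) (τ : ℝ)
    (S : Finset (Fin n)) (z : Feature d) :
    excess κ (leafPredict sel y (leafAt r x ω τ S z)) z ≤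
      ∑ k, (deviation m (labelProb κ k) x z (leafAt 0 x ω τ S z) +
        noise κ m k x y (leafAt 0 x ω τ S z)) := by
  by_cases hA : (leafAt 0 x ω τ S z).card ≤ m
  · simp only [deviation, noise, if_pos hA, add_zero]
    refine (excess_le_one κ _ z).trans ?_
    have : (1 : ℝ≥0∞) ≤ Fintype.card K := by exact_mod_cast Fintype.card_pos
    simpa using this
  · rw [leafAt_eq_of_lt_card r x ω τ S z (by omega)]
    set A := leafAt 0 x ω τ S z
    refine (excess_leafPredict_le κ hsel y (Finset.card_pos.1 (by omega)) z).trans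
      (Finset.sum_le_sum fun k _ => ?_)
    rw [deviation, noise, if_neg hA, if_neg hA,
      ← ENNReal.ofReal_add (abs_nonneg _) (abs_nonneg _)]
    apply ENNReal.ofReal_le_ofReal
    rw [add_comm]
    exact abs_sub_le _ _ _

omit [Fintype K] [Nonempty K] in
lemma lintegral_noise_le [IsMarkovKernel κ] (m : ℕ) (k : K) (x : Fin n → Feature d)
    (A : Finset (Fin n)) :
    ∫⁻ y, noise κ m k x y A ∂piKernel n κ x ≤ ENNReal.ofReal (1 / √(m + 1 : ℝ)) := by
  by_cases hA : A.card ≤ m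
  · simp [noise, hA]
  simp only [noise, if_neg hA]
  refine (lintegral_frequency_sub_le (fun i => κ (x i)) k (Finset.card_pos.1 (by omega))).trans ?_
  apply ENNReal.ofReal_le_ofReal
  have : (m + 1 : ℝ) ≤ A.card := by exact_mod_cast (by omega : m + 1 ≤ A.card)
  gcongr

end Vote

section Tree

variable {d n : ℕ} [NeZero d] {K : Type*} [Fintype K] [Nonempty K] [MeasurableSpace K]
  [MeasurableSingletonClass K]

omit [NeZero d] [Nonempty K] in
lemma measurable_leafPredict (sel : (K → ℕ) → K) (r : ℕ) (τ : ℝ) :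
    Measurable fun a : (Fin n → Feature d × K) × (Finset (Fin n) → Cut d) × Feature d =>
      leafPredict sel (fun i => (a.1 i).2)
        (leafAt r (fun i => (a.1 i).1) a.2.1 τ Finset.univ a.2.2) := by
  refine measurable_of_finite_index
    (F := fun (b : (Fin n → K) × Finset (Fin n))
      (_ : (Fin n → Feature d × K) × (Finset (Fin n) → Cut d) × Feature d) =>
        leafPredict sel b.1 b.2)
    (g := fun a => (fun i => (a.1 i).2, leafAt r (fun i => (a.1 i).1) a.2.1 τ Finset.univ a.2.2))
    ?_ fun _ => measurable_const
  rintro ⟨y, A⟩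
  simp only [Prod.mk.injEq]
  refine MeasurableSet.inter ?_ ?_
  · exact (measurableSet_singleton y).preimage
      (f := fun a : (Fin n → Feature d × K) × (Finset (Fin n) → Cut d) × Feature d =>
        fun i => (a.1 i).2) (by fun_prop)
  · exact (measurableSet_leafAt_eq r Finset.univ A).preimage
      (f := fun a : (Fin n → Feature d × K) × (Finset (Fin n) → Cut d) × Feature d =>
        (fun i => (a.1 i).1, a.2.1, τ, a.2.2)) (by fun_prop)

omit [NeZero d] [Nonempty K] in
lemma measurable_forestPredict (sel : (K → ℕ) → K) (r M : ℕ) (τ : ℝ) :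
    Measurable fun a : (Fin n → Feature d × K) × Feature d × (Fin M → Finset (Fin n) → Cut d) =>
      forestPredict sel (fun i => (a.1 i).2)
        (fun m => hullCut r (fun i => (a.1 i).1) (a.2.2 m) τ Finset.univ) a.2.1 := by
  have h (m : Fin M) : Measurable
      fun a : (Fin n → Feature d × K) × Feature d × (Fin M → Finset (Fin n) → Cut d) =>
        leafPredict sel (fun i => (a.1 i).2)
          (leafAt r (fun i => (a.1 i).1) (a.2.2 m) τ Finset.univ a.2.1) :=
    (measurable_leafPredict sel r τ).comp (by fun_prop : Measurable
      fun a : (Fin n → Feature d × K) × Feature d × (Fin M → Finset (Fin n) → Cut d) =>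
        (a.1, a.2.2 m, a.2.1))
  have hF : Measurable fun b : Fin M → K =>
      sel fun k => (Finset.univ.filter fun m => b m = k).card := Measurable.of_discrete
  exact hF.comp (measurable_pi_lambda _ h)

/-- The mean excess risk of one tree. -/
def treeExcess (ν : Measure (Feature d)) (κ : Kernel (Feature d) K) (sel : (K → ℕ) → K) (r : ℕ)
    (τ : ℝ) (data : Fin n → Feature d × K) : ℝ≥0∞ :=
  ∫⁻ ω, ∫⁻ z, excess κ (leafPredict sel (fun i => (data i).2)
    (leafAt r (fun i => (data i).1) ω τ Finset.univ z)) z ∂ν ∂treeLaw fun i => (data i).1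

variable (ν : Measure (Feature d)) [IsProbabilityMeasure ν] (κ : Kernel (Feature d) K)
  [IsMarkovKernel κ]

omit [IsMarkovKernel κ] [NeZero d] [IsProbabilityMeasure ν] in
lemma measurable_excess_comp {α : Type*} [MeasurableSpace α] {g : α → K} {z : α → Feature d}
    (hg : Measurable g) (hz : Measurable z) : Measurable fun a => excess κ (g a) (z a) :=
  measurable_of_finite_index (F := fun k a => excess κ k (z a))
    (fun k => hg (measurableSet_singleton k)) fun k => (measurable_excess κ k).comp hz

omit [IsMarkovKernel κ] in
lemma measurable_treeExcess (sel : (K → ℕ) → K) (r : ℕ) (τ : ℝ) :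
    Measurable (treeExcess (n := n) ν κ sel r τ) := by
  have h1 : Measurable fun b : ((Fin n → Feature d × K) × (Finset (Fin n) → Cut d)) × Feature d =>
      excess κ (leafPredict sel (fun i => (b.1.1 i).2)
        (leafAt r (fun i => (b.1.1 i).1) b.1.2 τ Finset.univ b.2)) b.2 :=
    measurable_excess_comp κ ((measurable_leafPredict sel r τ).comp (by fun_prop : Measurable
      fun b : ((Fin n → Feature d × K) × (Finset (Fin n) → Cut d)) × Feature d =>
        (b.1.1, b.1.2, b.2))) measurable_snd
  have h2 := h1.lintegral_prod_right' (ν := ν)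
  exact h2.lintegral_kernel_prod_right' (κ := (treeKernel d n).comap
    (fun data : Fin n → Feature d × K => fun i => (data i).1) (by fun_prop))

omit [NeZero d] in
lemma measurableSet_leafAt_fixed (x : Fin n → Feature d) (τ : ℝ) (A : Finset (Fin n)) :
    MeasurableSet
      {p : (Finset (Fin n) → Cut d) × Feature d | leafAt 0 x p.1 τ Finset.univ p.2 = A} :=
  (measurableSet_leafAt_eq 0 Finset.univ A).preimage
    (f := fun p : (Finset (Fin n) → Cut d) × Feature d => (x, p.1, τ, p.2)) (by fun_prop)

omit [NeZero d] in
lemma measurable_deviation_leafAt (x : Fin n → Feature d) {q : Feature d → ℝ} (hq : Measurable q)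
    (m : ℕ) (τ : ℝ) : Measurable fun p : (Finset (Fin n) → Cut d) × Feature d =>
      deviation m q x p.2 (leafAt 0 x p.1 τ Finset.univ p.2) := by
  have h (A : Finset (Fin n)) : Measurable fun p : (Finset (Fin n) → Cut d) × Feature d =>
      deviation m q x p.2 A := by
    have h1 := measurable_deviation (m := m) hq A
    have h2 : Measurable fun p : (Finset (Fin n) → Cut d) × Feature d => (x, p.2) := by fun_prop
    simpa only [Function.comp_def] using h1.comp h2
  exact measurable_of_finite_index (F := fun A (p : (Finset (Fin n) → Cut d) × Feature d) =>
    deviation m q x p.2 A) (measurableSet_leafAt_fixed x τ) h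

omit [NeZero d] [Nonempty K] [IsMarkovKernel κ] in
lemma measurable_noise_leafAt (x : Fin n → Feature d) (k : K) (m : ℕ) (τ : ℝ) :
    Measurable fun b : (Fin n → K) × (Finset (Fin n) → Cut d) × Feature d =>
      noise κ m k x b.1 (leafAt 0 x b.2.1 τ Finset.univ b.2.2) := by
  have h (A : Finset (Fin n)) : Measurable
      fun b : (Fin n → K) × (Finset (Fin n) → Cut d) × Feature d => noise κ m k x b.1 A := by
    have h1 : Measurable fun y : Fin n → K => noise κ m k x y A := Measurable.of_discrete
    simpa only [Function.comp_def] using h1.comp measurable_fst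
  exact measurable_of_finite_index
    (F := fun A (b : (Fin n → K) × (Finset (Fin n) → Cut d) × Feature d) =>
      noise κ m k x b.1 A)
    (fun A => (measurableSet_leafAt_fixed x τ A).preimage measurable_snd) h

lemma lintegral_treeExcess_le {sel : (K → ℕ) → K} (hsel : IsPlurality sel) {r m : ℕ}
    (hrm : r ≤ m) (τ : ℝ) :
    ∫⁻ data : Fin n → Feature d × K, treeExcess ν κ sel r τ data
      ∂Measure.pi (fun _ => ν ⊗ₘ κ) ≤
    ∑ k, ∫⁻ x : Fin n → Feature d, ∫⁻ z, leafMean x z (deviation m (labelProb κ k) x z)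
      Finset.univ τ ∂ν ∂Measure.pi (fun _ => ν) +
    Fintype.card K * ENNReal.ofReal (1 / √(m + 1 : ℝ)) := by
  rw [lintegral_pi_compProd ν κ (measurable_treeExcess ν κ sel r τ)]
  have hdevm (k : K) : Measurable fun x : Fin n → Feature d =>
      ∫⁻ z, leafMean x z (deviation m (labelProb κ k) x z) Finset.univ τ ∂ν := by
    have h : Measurable fun a : (Fin n → Feature d) × Feature d =>
        leafMean a.1 a.2 (deviation m (labelProb κ k) a.1 a.2) Finset.univ τ :=
      measurable_leafMean_comp (Φ := deviation m (labelProb κ k))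
        (fun A => measurable_deviation (measurable_labelProb κ k) A) measurable_fst measurable_snd τ
    exact h.lintegral_prod_right'
  rw [← lintegral_finsetSum _ fun k _ => hdevm k]
  have hconst : (Fintype.card K : ℝ≥0∞) * ENNReal.ofReal (1 / √(m + 1 : ℝ)) =
      ∫⁻ _x : Fin n → Feature d, Fintype.card K * ENNReal.ofReal (1 / √(m + 1 : ℝ))
        ∂Measure.pi (fun _ => ν) := by simp
  rw [hconst, ← lintegral_add_right _ measurable_const]
  refine lintegral_mono fun x => ?_
  set ρ := (treeLaw x).prod ν with hρ
  have hdev (k : K) := measurable_deviation_leafAt x (measurable_labelProb κ k) m τ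
  have hnoise (k : K) := measurable_noise_leafAt κ x k m τ
  have hpt (y : Fin n → K) : treeExcess ν κ sel r τ (fun i => (x i, y i)) ≤
      ∑ k, ∫⁻ z, leafMean x z (deviation m (labelProb κ k) x z) Finset.univ τ ∂ν +
      ∑ k, ∫⁻ p, noise κ m k x y (leafAt 0 x p.1 τ Finset.univ p.2) ∂ρ := by
    have hnoise' (k : K) : Measurable fun p : (Finset (Fin n) → Cut d) × Feature d =>
        noise κ m k x y (leafAt 0 x p.1 τ Finset.univ p.2) := by
      have h2 : Measurable fun p : (Finset (Fin n) → Cut d) × Feature d => (y, p) := by fun_prop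
      simpa only [Function.comp_def] using (hnoise k).comp h2
    calc treeExcess ν κ sel r τ (fun i => (x i, y i))
        ≤ ∫⁻ ω, ∫⁻ z, ∑ k, (deviation m (labelProb κ k) x z (leafAt 0 x ω τ Finset.univ z) +
            noise κ m k x y (leafAt 0 x ω τ Finset.univ z)) ∂ν ∂treeLaw x :=
          lintegral_mono fun ω => lintegral_mono fun z =>
            excess_leafAt_le κ hsel hrm x y ω τ Finset.univ z
      _ = ∫⁻ p, ∑ k, (deviation m (labelProb κ k) x p.2 (leafAt 0 x p.1 τ Finset.univ p.2) +
            noise κ m k x y (leafAt 0 x p.1 τ Finset.univ p.2)) ∂ρ :=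
          (lintegral_prod _ (Finset.measurable_sum _
            fun k _ => (hdev k).add (hnoise' k)).aemeasurable).symm
      _ = _ := by
          have hadd (k : K) : Measurable fun p : (Finset (Fin n) → Cut d) × Feature d =>
              deviation m (labelProb κ k) x p.2 (leafAt 0 x p.1 τ Finset.univ p.2) +
                noise κ m k x y (leafAt 0 x p.1 τ Finset.univ p.2) := (hdev k).add (hnoise' k)
          rw [lintegral_finsetSum _ fun k _ => hadd k, ← Finset.sum_add_distrib]
          refine Finset.sum_congr rfl fun k _ => ?_
          rw [lintegral_add_left (hdev k), hρ, lintegral_prod_symm' _ (hdev k)]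
          rfl
  refine (lintegral_mono hpt).trans ?_
  rw [lintegral_add_left measurable_const, lintegral_const, measure_univ, mul_one]
  gcongr
  have hnoiseint (k : K) : Measurable fun y : Fin n → K =>
      ∫⁻ p, noise κ m k x y (leafAt 0 x p.1 τ Finset.univ p.2) ∂ρ :=
    (hnoise k).lintegral_prod_right'
  rw [lintegral_finsetSum _ fun k _ => hnoiseint k]
  refine (Finset.sum_le_card_nsmul _ _ _ fun k _ => ?_).trans (le_of_eq (nsmul_eq_mul _ _))
  -- Given the features, labels are independent of tree and query, so they can be averaged first,
  -- with the leaf a fixed set.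
  rw [lintegral_lintegral_swap (hnoise k).aemeasurable]
  refine (lintegral_mono fun p => lintegral_noise_le κ m k x _).trans ?_
  simp [hρ]

/-- Each tree is consistent. -/
lemma tendsto_treeExcess (hd : 2 ≤ d) {sel : (K → ℕ) → K} (hsel : IsPlurality sel) (r : ℕ)
    {τ : ℕ → ℝ} (hτ : Tendsto τ atTop atTop)
    (hτn : Tendsto (fun n : ℕ => τ n ^ d / (n : ℝ)) atTop (𝓝 0)) :
    Tendsto (fun n : ℕ => ∫⁻ data : Fin n → Feature d × K, treeExcess ν κ sel r (τ n) data
      ∂Measure.pi (fun _ => ν ⊗ₘ κ)) atTop (𝓝 0) := by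
  rw [ENNReal.tendsto_nhds_zero]
  intro ε hε
  have hm : Tendsto (fun m : ℕ => (Fintype.card K : ℝ≥0∞) * ENNReal.ofReal (1 / √(m + 1 : ℝ)))
      atTop (𝓝 0) := by
    have h1 : Tendsto (fun m : ℕ => 1 / √(m + 1 : ℝ)) atTop (𝓝 0) :=
      (tendsto_const_nhds (x := (1:ℝ))).div_atTop (Real.tendsto_sqrt_atTop.comp
        (tendsto_atTop_add_const_right _ 1 tendsto_natCast_atTop_atTop))
    have h2 := ENNReal.tendsto_ofReal h1
    rw [ENNReal.ofReal_zero] at h2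
    have h3 := ENNReal.Tendsto.const_mul (a := (Fintype.card K : ℝ≥0∞)) h2
      (Or.inr (ENNReal.natCast_ne_top _))
    rwa [mul_zero] at h3
  have hε2 : 0 < ε / 2 := ENNReal.half_pos hε.ne'
  -- The leaf size m is fixed first, to control the noise uniformly in n; the bias then vanishes for
  -- this m.
  obtain ⟨m, hm1, hm2⟩ := ((ENNReal.tendsto_nhds_zero.1 hm _ hε2).and
    (eventually_ge_atTop r)).exists
  have hdev := tendsto_finsetSum (Finset.univ : Finset K) fun k _ =>
    tendsto_deviation ν hd (measurable_labelProb κ k) (labelProb_mem κ k) m hτ hτn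
  simp only [Finset.sum_const_zero] at hdev
  filter_upwards [ENNReal.tendsto_nhds_zero.1 hdev _ hε2] with n hn
  refine (lintegral_treeExcess_le ν κ hsel hm2 (τ n)).trans ?_
  rw [← ENNReal.add_halves ε]
  exact add_le_add hn hm1

end Tree

end

end BSPForest

/-! ### The error of the forest against the Bayes error -/

namespace BSPForest

noncomputable section

open scoped Classical ENNReal

section Forest

variable {d n : ℕ} [NeZero d] {K : Type*} [Fintype K] [MeasurableSpace K]
  [MeasurableSingletonClass K]

omit [NeZero d] in
lemma measurableSet_forest_error (sel : (K → ℕ) → K) (r M : ℕ) (τ : ℝ) :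
    MeasurableSet {a : (Fin n → Feature d × K) ×
      (Feature d × K) × (Fin M → Finset (Fin n) → Cut d) |
      forestPredict sel (fun i => (a.1 i).2)
        (fun m => hullCut r (fun i => (a.1 i).1) (a.2.2 m) τ Finset.univ) a.2.1.1 ≠ a.2.1.2} := by
  have h1 := measurable_forestPredict (d := d) (n := n) sel r M τ
  have h2 : Measurable fun a : (Fin n → Feature d × K) ×
      (Feature d × K) × (Fin M → Finset (Fin n) → Cut d) => (a.1, a.2.1.1, a.2.2) := by fun_prop
  have h3 : Measurable fun a : (Fin n → Feature d × K) ×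
      (Feature d × K) × (Fin M → Finset (Fin n) → Cut d) => a.2.1.2 := by fun_prop
  exact (measurableSet_eq_fun (h1.comp h2) h3).compl

variable (μ : Measure (Feature d × K)) [IsProbabilityMeasure μ]

lemma measurable_errorProb (sel : (K → ℕ) → K) (M r : ℕ) (τ : ℝ) :
    Measurable fun data : Fin n → Feature d × K => errorProb μ sel M r τ data := by
  let κ : Kernel (Fin n → Feature d × K) (Fin M → Finset (Fin n) → Cut d) :=
    (piKernel M (treeKernel d n)).comap (fun data _ i => (data i).1) (by fun_prop)
  have h := Kernel.measurable_kernel_prodMk_left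
    (κ := (Kernel.const (Fin n → Feature d × K) μ).prod κ)
    (measurableSet_forest_error (d := d) (n := n) sel r M τ)
  have h2 := h.ennreal_toReal
  simp only [Kernel.prod_apply, Kernel.const_apply] at h2
  exact h2

omit [Fintype K] [MeasurableSingletonClass K] in
lemma errorProb_mem (sel : (K → ℕ) → K) (M r : ℕ) (τ : ℝ) (data : Fin n → Feature d × K) :
    errorProb μ sel M r τ data ∈ Set.Icc (0:ℝ) 1 := ⟨measureReal_nonneg, measureReal_le_one⟩

lemma integrable_errorProb (sel : (K → ℕ) → K) (M r : ℕ) (τ : ℝ) :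
    Integrable (fun data : Fin n → Feature d × K => errorProb μ sel M r τ data)
      (Measure.pi fun _ => μ) :=
  Integrable.of_bound (measurable_errorProb μ sel M r τ).aestronglyMeasurable 1
    (Eventually.of_forall fun data => by
      rw [Real.norm_of_nonneg (errorProb_mem μ sel M r τ data).1]
      exact (errorProb_mem μ sel M r τ data).2)

omit [NeZero d] in
lemma measurable_forestPredict_fixed (sel : (K → ℕ) → K) (r : ℕ) {M : ℕ} (τ : ℝ)
    (data : Fin n → Feature d × K) (ω : Fin M → Finset (Fin n) → Cut d) :
    Measurable fun z => forestPredict sel (fun i => (data i).2)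
      (fun m => hullCut r (fun i => (data i).1) (ω m) τ Finset.univ) z := by
  have h1 := measurable_forestPredict (d := d) (n := n) sel r M τ
  have h2 : Measurable fun z : Feature d => (data, z, ω) := by fun_prop
  simpa only [Function.comp_def] using h1.comp h2

lemma ofReal_errorProb (sel : (K → ℕ) → K) (M r : ℕ) (τ : ℝ) (data : Fin n → Feature d × K) :
    ENNReal.ofReal (errorProb μ sel M r τ data) =
      ∫⁻ ω, μ {q | forestPredict sel (fun i => (data i).2)
        (fun m => hullCut r (fun i => (data i).1) (ω m) τ Finset.univ) q.1 ≠ q.2}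
        ∂Measure.pi fun _ : Fin M => treeLaw fun i => (data i).1 := by
  have hm : MeasurableSet {q : (Feature d × K) × (Fin M → Finset (Fin n) → Cut d) |
      forestPredict sel (fun i => (data i).2)
        (fun m => hullCut r (fun i => (data i).1) (q.2 m) τ Finset.univ) q.1.1 ≠ q.1.2} :=
    measurable_prodMk_left (x := data) (measurableSet_forest_error sel r M τ)
  rw [errorProb, ofReal_measureReal, Measure.prod_apply_symm hm]
  rfl

/-- For fixed data and trees the forest is a measurable classifier; its error is then averaged over
the trees. -/
lemma bayesError_le_errorProb (sel : (K → ℕ) → K) (M r : ℕ) (τ : ℝ)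
    (data : Fin n → Feature d × K) : bayesError μ ≤ errorProb μ sel M r τ data := by
  rw [← ENNReal.ofReal_le_ofReal_iff (errorProb_mem μ sel M r τ data).1, ofReal_errorProb]
  have h (ω : Fin M → Finset (Fin n) → Cut d) : ENNReal.ofReal (bayesError μ) ≤
      μ {q | forestPredict sel (fun i => (data i).2)
        (fun m => hullCut r (fun i => (data i).1) (ω m) τ Finset.univ) q.1 ≠ q.2} := by
    rw [← ofReal_measureReal]
    apply ENNReal.ofReal_le_ofReal
    exact ciInf_le ⟨0, by rintro _ ⟨g, rfl⟩; exact measureReal_nonneg⟩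
      (⟨_, measurable_forestPredict_fixed sel r τ data ω⟩ :
        {g : Feature d → K // Measurable g})
  refine le_trans ?_ (lintegral_mono h)
  simp

variable [Nonempty K] (ν : Measure (Feature d)) [IsProbabilityMeasure ν]
  (κ : Kernel (Feature d) K) [IsMarkovKernel κ]

/-- The excess of the forest is at most the sum over its trees, which all have the same law: only
their marginals enter. -/
lemma ofReal_errorProb_le {sel : (K → ℕ) → K} (hsel : IsPlurality sel) {M : ℕ} (hM : 0 < M)
    (r : ℕ) (τ : ℝ) (data : Fin n → Feature d × K) :
    ENNReal.ofReal (errorProb (ν ⊗ₘ κ) sel M r τ data) ≤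
      ∫⁻ z, leastRisk κ z ∂ν + M * treeExcess ν κ sel r τ data := by
  set x : Fin n → Feature d := fun i => (data i).1 with hx
  set y : Fin n → K := fun i => (data i).2 with hy
  have hT : Measurable fun b : (Finset (Fin n) → Cut d) × Feature d =>
      excess κ (leafPredict sel y (leafAt r x b.1 τ Finset.univ b.2)) b.2 := by
    have h1 := measurable_leafPredict (d := d) (n := n) sel r τ
    have h2 : Measurable fun b : (Finset (Fin n) → Cut d) × Feature d => (data, b.1, b.2) := by
      fun_prop
    have h3 := measurable_excess_comp κ (h1.comp h2) measurable_snd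
    simpa only [Function.comp_def] using h3
  have hT' : Measurable fun ω : Finset (Fin n) → Cut d => ∫⁻ z,
      excess κ (leafPredict sel y (leafAt r x ω τ Finset.univ z)) z ∂ν := hT.lintegral_prod_right'
  have hTm (m : Fin M) : Measurable fun ω : Fin M → Finset (Fin n) → Cut d => ∫⁻ z,
      excess κ (leafPredict sel y (leafAt r x (ω m) τ Finset.univ z)) z ∂ν := by
    simpa only [Function.comp_def] using hT'.comp (measurable_pi_apply m)
  rw [ofReal_errorProb]
  have h (ω : Fin M → Finset (Fin n) → Cut d) : (ν ⊗ₘ κ) {q | forestPredict sel y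
        (fun m => hullCut r x (ω m) τ Finset.univ) q.1 ≠ q.2} ≤
      ∫⁻ z, leastRisk κ z ∂ν + ∑ m, ∫⁻ z,
        excess κ (leafPredict sel y (leafAt r x (ω m) τ Finset.univ z)) z ∂ν := by
    rw [misclassified_eq κ ν (measurable_forestPredict_fixed sel r τ data ω)]
    gcongr
    rw [← lintegral_finsetSum]
    · refine lintegral_mono fun z => ?_
      have hz := excess_forestPredict_le κ hsel hM y (fun m => hullCut r x (ω m) τ Finset.univ) z
      simp only [treePredict_hullCut] at hz
      exact hz
    · intro m _
      have h2 : Measurable fun z : Feature d => (ω m, z) := by fun_prop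
      simpa only [Function.comp_def] using hT.comp h2
  refine (lintegral_mono h).trans ?_
  rw [lintegral_add_left measurable_const, lintegral_const, measure_univ, mul_one,
    lintegral_finsetSum _ fun m _ => hTm m]
  gcongr
  refine (Finset.sum_le_card_nsmul _ _ (treeExcess ν κ sel r τ data) fun m _ => le_of_eq ?_).trans
    (by simp)
  exact (measurePreserving_eval (fun _ : Fin M => treeLaw x) m).lintegral_comp hT'

omit [NeZero d] in
lemma lintegral_leastRisk_le (g : {g : Feature d → K // Measurable g}) :
    ∫⁻ z, leastRisk κ z ∂ν ≤ (ν ⊗ₘ κ) {q | g.1 q.1 ≠ q.2} := by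
  rw [misclassified_eq κ ν g.2]
  exact le_self_add

/-- The mean error is squeezed between the Bayes error and the least risk plus M times the mean
excess of a tree. The least risk is at most the Bayes error; equality is not needed. -/
lemma tendsto_lintegral_errorProb (hd : 2 ≤ d) {sel : (K → ℕ) → K} (hsel : IsPlurality sel)
    {M : ℕ} (hM : 0 < M) (r : ℕ) {τ : ℕ → ℝ} (hτ : Tendsto τ atTop atTop)
    (hτn : Tendsto (fun n : ℕ => τ n ^ d / (n : ℝ)) atTop (𝓝 0)) :
    Tendsto (fun n : ℕ => ∫ data : Fin n → Feature d × K, errorProb (ν ⊗ₘ κ) sel M r (τ n) data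
      ∂Measure.pi fun _ => ν ⊗ₘ κ) atTop (𝓝 (bayesError (ν ⊗ₘ κ))) := by
  set L := ∫⁻ z, leastRisk κ z ∂ν with hL
  have : Nonempty {g : Feature d → K // Measurable g} :=
    ⟨⟨fun _ => Classical.arbitrary K, measurable_const⟩⟩
  have hLtop : L ≠ ∞ :=
    ne_top_of_le_ne_top (measure_ne_top _ _) (lintegral_leastRisk_le ν κ (Classical.arbitrary _))
  have hLb : L.toReal ≤ bayesError (ν ⊗ₘ κ) :=
    le_ciInf fun g => ENNReal.toReal_mono (measure_ne_top _ _) (lintegral_leastRisk_le ν κ g)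
  have hlim : Tendsto (fun n : ℕ => bayesError (ν ⊗ₘ κ) + ((M : ℝ≥0∞) *
      ∫⁻ data : Fin n → Feature d × K, treeExcess ν κ sel r (τ n) data
        ∂Measure.pi fun _ => ν ⊗ₘ κ).toReal) atTop (𝓝 (bayesError (ν ⊗ₘ κ))) := by
    have h := ENNReal.Tendsto.const_mul (a := (M : ℝ≥0∞))
      (tendsto_treeExcess ν κ hd hsel r hτ hτn) (Or.inr (ENNReal.natCast_ne_top _))
    rw [mul_zero] at h
    simpa using ((ENNReal.tendsto_toReal ENNReal.zero_ne_top).comp h).const_add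
      (bayesError (ν ⊗ₘ κ))
  refine tendsto_of_tendsto_of_tendsto_of_le_of_le tendsto_const_nhds hlim (fun n => ?_)
    fun n => ?_
  · have h := integral_mono (integrable_const (bayesError (ν ⊗ₘ κ)))
      (integrable_errorProb (n := n) (ν ⊗ₘ κ) sel M r (τ n))
      fun data => bayesError_le_errorProb (ν ⊗ₘ κ) sel M r (τ n) data
    simpa using h
  · have hle : ∫⁻ data : Fin n → Feature d × K,
        ENNReal.ofReal (errorProb (ν ⊗ₘ κ) sel M r (τ n) data) ∂Measure.pi (fun _ => ν ⊗ₘ κ) ≤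
        L + (M : ℝ≥0∞) * ∫⁻ data : Fin n → Feature d × K, treeExcess ν κ sel r (τ n) data
          ∂Measure.pi fun _ => ν ⊗ₘ κ := by
      refine (lintegral_mono fun data => ofReal_errorProb_le ν κ hsel hM r (τ n) data).trans ?_
      rw [lintegral_add_left measurable_const, lintegral_const, measure_univ, mul_one,
        lintegral_const_mul _ (measurable_treeExcess ν κ sel r (τ n))]
    have hfin : (M : ℝ≥0∞) * ∫⁻ data : Fin n → Feature d × K, treeExcess ν κ sel r (τ n) data
        ∂Measure.pi (fun _ => ν ⊗ₘ κ) ≠ ∞ := by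
      refine ENNReal.mul_ne_top (ENNReal.natCast_ne_top _)
        (ne_top_of_le_ne_top ENNReal.one_ne_top ?_)
      calc _ ≤ ∫⁻ _data : Fin n → Feature d × K, 1 ∂Measure.pi (fun _ => ν ⊗ₘ κ) := by
            refine lintegral_mono fun data => ?_
            refine (lintegral_mono fun ω => lintegral_mono fun z =>
              excess_le_one κ _ z).trans ?_
            simp
        _ = 1 := by simp
    rw [integral_eq_lintegral_of_nonneg_ae
      (Eventually.of_forall fun data => (errorProb_mem _ sel M r (τ n) data).1)
      (measurable_errorProb _ sel M r (τ n)).aestronglyMeasurable]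
    refine (ENNReal.toReal_mono (ENNReal.add_ne_top.2 ⟨hLtop, hfin⟩) hle).trans ?_
    rw [ENNReal.toReal_add hLtop hfin]
    gcongr

end Forest

end

end BSPForest

theorem theorem2 {d : ℕ} [NeZero d] (hd : 2 ≤ d)
    {K : Type*} [Fintype K] [MeasurableSpace K] [MeasurableSingletonClass K]
    (μ : Measure (BSPForest.Feature d × K)) [IsProbabilityMeasure μ]
    (sel : (K → ℕ) → K) (hsel : BSPForest.IsPlurality sel)
    (M : ℕ) (hM : 0 < M) (r : ℕ)
    (τ : ℕ → ℝ) (hτ : Tendsto τ atTop atTop)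
    (hτn : Tendsto (fun n : ℕ => τ n ^ d / (n : ℝ)) atTop (𝓝 0)) :
    (∀ n : ℕ, Integrable
      (fun data : Fin n → BSPForest.Feature d × K =>
        BSPForest.errorProb μ sel M r (τ n) data) (Measure.pi fun _ : Fin n => μ)) ∧
    Tendsto (fun n : ℕ => ∫ data : Fin n → BSPForest.Feature d × K,
        BSPForest.errorProb μ sel M r (τ n) data ∂(Measure.pi fun _ : Fin n => μ))
      atTop (𝓝 (BSPForest.bayesError μ)) := by
  refine ⟨fun n => BSPForest.integrable_errorProb μ sel M r (τ n), ?_⟩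
  have : Nonempty K := ⟨sel 0⟩
  -- The label space is finite and discrete, so any `μ` disintegrates into its feature marginal and
  -- a Markov kernel of conditional label laws.
  have h := BSPForest.tendsto_lintegral_errorProb μ.fst μ.condKernel hd hsel hM r hτ hτn
  rwa [μ.disintegrate μ.condKernel] at h
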